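/- Let $N\ge 1$, let $q\in\mathbb C^\times$ with $q^2\neq 1$, and let $\eta_1,\dots,\eta_N\in\mathbb C^\times$ satisfy $$\eta_a\neq \pm q^{j}\eta_b\qquad\text{for all } j\in\{-1,0,1\},\ 1\le a<b\le N.$$ On $\mathcal R=(\mathbb C^2)^{\otimes N}$ let $\sigma_n^{z}=\mathrm{diag}(1,-1)$, $\sigma_n^+=\begin{pmatrix}0&1\\0&0\end{pmatrix}$, $\sigma_n^-=\begin{pmatrix}0&0\\1&0\end{pmatrix}$ act on the $n$-th factor. For $\lambda\in\mathbb C^\times$ put $x_\pm(\lambda)=\tfrac12\big(\lambda q-(\lambda q)^{-1}\pm(\lambda-\lambda^{-1})\big)$, $$L_n(\lambda)=\begin{pmatrix}x_+(\lambda)+x_-(\lambda)\sigma_n^z&(q-q^{-1})\sigma_n^-\\(q-q^{-1})\sigma_n^+&x_+(\lambda)-x_-(\lambda)\sigma_n^z\end{pmatrix},\qquad \begin{pmatrix}A(\lambda)&B(\lambda)\\C(\lambda)&D(\lambda)\end{pmatrix}=L_N(\lambda/\eta_N)\cdots L_1(\lambda/\eta_1),$$ $\bar T(\lambda)=B(\lambda)+C(\lambda)$,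 and $$a(\lambda)=-\prod_{n=1}^N\Big(\frac{\lambda q}{\eta_n}-\frac{\eta_n}{\lambda q}\Big),\qquad d(\lambda)=\prod_{n=1}^N\Big(\frac{\lambda}{\eta_n}-\frac{\eta_n}{\lambda}\Big).$$ Let $\Sigma$ be the set of functions $t:\mathbb C^\times\to\mathbb C$ for which there is a vector $v\in\mathcal R$, $v\ne0$, with $\bar T(\lambda)v=t(\lambda)v$ for all $\lambda\in\mathbb C^\times$. Let $|0\rangle$ (resp. $\langle 0|$) be the basis vector (resp. dual basis covector) with all spins $+1$, let $\mathsf n=\prod_{b<a}(\eta_a/\eta_b-\eta_b/\eta_a)^{1/2}$ (principal roots), and for $h\in\{0,1\}^N$ $$\langle h|=\frac1{\mathsf n}\langle0|\prod_{n=1}^N\Big(\frac{C(\eta_n)}{d(\eta_n/q)}\Big)^{h_n},\qquad |h\rangle=\frac1{\mathsf n}\prod_{n=1}^N\Big(\frac{B(\eta_n)}{a(\eta_n)}\Big)^{h_n}|0\rangle,$$ the products being ordered with $n=1,\dots,N$ from left to right. For $Q:\mathbb C^\times\to\mathbb C$ put $$c_Q(h)=\prod_{a=1}^N\frac{Q(\eta_aq^{-h_a})}{(\eta_aq^{-h_a})^{N-1}}\prod_{1\le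 b<a\le N}\big(\eta_a^2q^{-2h_a}-\eta_b^2q^{-2h_b}\big),\qquad |Q\rangle=\sum_{h}c_Q(h)\,|h\rangle,\qquad \langle Q|=\sum_h c_Q(h)\,\langle h|.$$ Then: 1. The spectrum of $\bar T$ is simple: for every $t\in\Sigma$ the space of vectors $v$ with $\bar T(\lambda)v=t(\lambda)v$ for all $\lambda$, and the space of covectors $w$ with $w\bar T(\lambda)=t(\lambda)w$ for all $\lambda$, are one-dimensional. 2. $\Sigma$ is exactly the set of functions $t(\lambda)$ given by Laurent polynomials with exponents between $-(N-1)$ and $N-1$, even if $N$ is odd and odd if $N$ is even, that satisfy $$t(\eta_a)\,t(\eta_a/q)=a(\eta_a)\,d(\eta_a/q)\qquad\text{for all } a\in\{1,\dots,N\}.$$ 3. Let $t\in\Sigma$. There are functions $Q$ with $$Q(\eta_a)\neq0,\qquad \frac{Q(\eta_a/q)}{Q(\eta_a)}=\frac{t(\eta_a)}{d(\eta_a/q)}\qquad\text{for all } a,$$ and a function $Q$ satisfies these relations if and only if $|Q\rangle$ is a (nonzero) right eigenvector of the family $\bar T(\lambda)$ with eigenvalue $t(\lambda)$. 4. Let $t\in\Sigma$.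 There are functions $\bar Q$ with $$\bar Q(\eta_a)\neq0,\qquad \frac{\bar Q(\eta_a/q)}{\bar Q(\eta_a)}=\frac{t(\eta_a)}{a(\eta_a)}\qquad\text{for all } a,$$ and a function $\bar Q$ satisfies these relations if and only if $\langle\bar Q|$ is a (nonzero) left eigenvector of the family $\bar T(\lambda)$ with eigenvalue $t(\lambda)$. -/

import Mathlib

open scoped Matrix

noncomputable section

namespace AntiperiodicSixVertex

/-- Spin configurations of a chain of `N` sites: the value `0` at a site means spin `+1` and the
value `1` means spin `-1`. The space `(ℂ²)^{⊗N}` is written in its standard tensor product basis as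
`Config N → ℂ`; vectors and covectors are both given by their coordinates, operators are matrices
acting by `*ᵥ` on vectors and by `ᵥ*` on covectors. -/
abbrev Config (N : ℕ) := Fin N → Fin 2

/-- Operators on the quantum space of the chain. -/
abbrev Op (N : ℕ) := Matrix (Config N) (Config N) ℂ

/-- The `2 × 2` matrix `X` acting at site `n`, the identity acting at all other sites. -/
def siteOp {N : ℕ} (n : Fin N) (X : Matrix (Fin 2) (Fin 2) ℂ) : Op N :=
  Matrix.of fun s s' => if ∀ m, m ≠ n → s m = s' m then X (s n) (s' n) else 0

def sigmaPlus : Matrix (Fin 2) (Fin 2) ℂ := !![0, 1; 0, 0]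

def sigmaMinus : Matrix (Fin 2) (Fin 2) ℂ := !![0, 0; 1, 0]

def sigmaZ : Matrix (Fin 2) (Fin 2) ℂ := !![1, 0; 0, -1]

/-- `x₊(l) = (l q - 1/(l q) + l - 1/l) / 2`. -/
def xPlus (q l : ℂˣ) : ℂ :=
  ((l : ℂ) * q - ((l : ℂ) * q)⁻¹ + ((l : ℂ) - (l : ℂ)⁻¹)) / 2

/-- `x₋(l) = (l q - 1/(l q) - l + 1/l) / 2`. -/
def xMinus (q l : ℂˣ) : ℂ :=
  ((l : ℂ) * q - ((l : ℂ) * q)⁻¹ - ((l : ℂ) - (l : ℂ)⁻¹)) / 2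

/-- The Lax operator of site `n`, a `2 × 2` matrix (auxiliary space) of operators on the chain. -/
def lax {N : ℕ} (q : ℂˣ) (n : Fin N) (l : ℂˣ) : Matrix (Fin 2) (Fin 2) (Op N) :=
  !![siteOp n (xPlus q l • (1 : Matrix (Fin 2) (Fin 2) ℂ) + xMinus q l • sigmaZ),
      siteOp n (((q : ℂ) - (q : ℂ)⁻¹) • sigmaMinus);
    siteOp n (((q : ℂ) - (q : ℂ)⁻¹) • sigmaPlus),
      siteOp n (xPlus q l • (1 : Matrix (Fin 2) (Fin 2) ℂ) - xMinus q l • sigmaZ)]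

/-- The monodromy matrix `L_N(l/η_N) ⋯ L_1(l/η_1)`. -/
def monodromy {N : ℕ} (q : ℂˣ) (η : Fin N → ℂˣ) (l : ℂˣ) : Matrix (Fin 2) (Fin 2) (Op N) :=
  (List.ofFn fun n => lax q n (l / η n)).reverse.prod

/-- The entry `B(l)` of the monodromy matrix. -/
def opB {N : ℕ} (q : ℂˣ) (η : Fin N → ℂˣ) (l : ℂˣ) : Op N := monodromy q η l 0 1

/-- The entry `C(l)` of the monodromy matrix. -/
def opC {N : ℕ} (q : ℂˣ) (η : Fin N → ℂˣ) (l : ℂˣ) : Op N := monodromy q η l 1 0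

/-- The antiperiodic transfer matrix `B(l) + C(l)`. -/
def transfer {N : ℕ} (q : ℂˣ) (η : Fin N → ℂˣ) (l : ℂˣ) : Op N := opB q η l + opC q η l

/-- `a(l) = - ∏ₙ (l q / ηₙ - ηₙ / (l q))`. -/
def aFun {N : ℕ} (q : ℂˣ) (η : Fin N → ℂˣ) (l : ℂˣ) : ℂ :=
  -∏ n, ((l : ℂ) * q / η n - (η n : ℂ) / (l * q))

/-- `d(l) = ∏ₙ (l / ηₙ - ηₙ / l)`. -/
def dFun {N : ℕ} (η : Fin N → ℂˣ) (l : ℂˣ) : ℂ :=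
  ∏ n, ((l : ℂ) / η n - (η n : ℂ) / l)

/-- Vectors `v` with `T̄(l) v = t(l) v` for all `l`. -/
def rightEigenspace {N : ℕ} (q : ℂˣ) (η : Fin N → ℂˣ) (t : ℂˣ → ℂ) :
    Submodule ℂ (Config N → ℂ) where
  carrier := {v | ∀ l, transfer q η l *ᵥ v = t l • v}
  add_mem' := by
    intro v w hv hw l
    rw [Matrix.mulVec_add, hv l, hw l, smul_add]
  zero_mem' := by
    intro l
    rw [Matrix.mulVec_zero, smul_zero]
  smul_mem' := by
    intro c v hv l
    rw [Matrix.mulVec_smul, hv l, smul_comm]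

/-- Covectors `v` with `v T̄(l) = t(l) v` for all `l`. -/
def leftEigenspace {N : ℕ} (q : ℂˣ) (η : Fin N → ℂˣ) (t : ℂˣ → ℂ) :
    Submodule ℂ (Config N → ℂ) where
  carrier := {v | ∀ l, v ᵥ* transfer q η l = t l • v}
  add_mem' := by
    intro v w hv hw l
    rw [Matrix.add_vecMul, hv l, hw l, smul_add]
  zero_mem' := by
    intro l
    rw [Matrix.zero_vecMul, smul_zero]
  smul_mem' := by
    intro c v hv l
    rw [Matrix.smul_vecMul, hv l, smul_comm]

/-- The set of eigenvalue functions of the family `T̄(l)`, `l ∈ ℂˣ`. -/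
def spectrumT {N : ℕ} (q : ℂˣ) (η : Fin N → ℂˣ) : Set (ℂˣ → ℂ) :=
  {t | ∃ v ∈ rightEigenspace q η t, v ≠ 0}

/-- Functions on `ℂˣ` given by Laurent polynomials of degree (at most) `N - 1`, i.e. with exponents
between `-(N-1)` and `N-1`, even for `N` odd and odd for `N` even. -/
def laurentClass (N : ℕ) : Set (ℂˣ → ℂ) :=
  {t | (∃ p : LaurentPolynomial ℂ, (∀ k ∈ p.coeff.support, |k| ≤ (N : ℤ) - 1) ∧
        ∀ l : ℂˣ, t l = LaurentPolynomial.eval₂ (RingHom.id ℂ) l p) ∧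
      (Odd N → Function.Even t) ∧ (Even N → Function.Odd t)}

/-- The normalization `∏_{b<a} (η_a/η_b - η_b/η_a)^{1/2}` (principal square roots). -/
def normConst {N : ℕ} (η : Fin N → ℂˣ) : ℂ :=
  ∏ a, ∏ b ∈ Finset.Iio a, ((η a : ℂ) / η b - (η b : ℂ) / η a) ^ (1 / 2 : ℂ)

/-- The reference state, all spins `+1`. -/
def refState (N : ℕ) : Config N → ℂ := Pi.single (fun _ => 0) 1

/-- The covector `⟨h_1,…,h_N|` of the left separated basis. -/
def sovBra {N : ℕ} (q : ℂˣ) (η : Fin N → ℂˣ) (h : Fin N → Fin 2) : Config N → ℂ :=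
  (normConst η)⁻¹ •
    (refState N ᵥ*
      (List.ofFn fun n => ((dFun η (η n / q))⁻¹ • opC q η (η n)) ^ (h n : ℕ)).prod)

/-- The vector `|h_1,…,h_N⟩` of the right separated basis. -/
def sovKet {N : ℕ} (q : ℂˣ) (η : Fin N → ℂˣ) (h : Fin N → Fin 2) : Config N → ℂ :=
  (normConst η)⁻¹ •
    ((List.ofFn fun n => ((aFun q η (η n))⁻¹ • opB q η (η n)) ^ (h n : ℕ)).prod *ᵥ refState N)

/-- The point `η_a q^{-h_a}`. -/
def sovPoint {N : ℕ} (q : ℂˣ) (η : Fin N → ℂˣ) (h : Fin N → Fin 2) (a : Fin N) : ℂˣ :=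
  η a / q ^ (h a : ℕ)

/-- The coefficient
`∏_a Q(η_a q^{-h_a}) / (η_a q^{-h_a})^{N-1} * ∏_{b<a} (η_a² q^{-2h_a} - η_b² q^{-2h_b})`. -/
def sovCoeff {N : ℕ} (q : ℂˣ) (η : Fin N → ℂˣ) (Q : ℂˣ → ℂ) (h : Fin N → Fin 2) : ℂ :=
  (∏ a, Q (sovPoint q η h a) / (sovPoint q η h a : ℂ) ^ (N - 1)) *
    ∏ a, ∏ b ∈ Finset.Iio a, ((sovPoint q η h a : ℂ) ^ 2 - (sovPoint q η h b : ℂ) ^ 2)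

/-- The vector with separated wave function `Q`. -/
def separateKet {N : ℕ} (q : ℂˣ) (η : Fin N → ℂˣ) (Q : ℂˣ → ℂ) : Config N → ℂ :=
  ∑ h : Fin N → Fin 2, sovCoeff q η Q h • sovKet q η h

/-- The covector with separated wave function `Q`. -/
def separateBra {N : ℕ} (q : ℂˣ) (η : Fin N → ℂˣ) (Q : ℂˣ → ℂ) : Config N → ℂ :=
  ∑ h : Fin N → Fin 2, sovCoeff q η Q h • sovBra q η h

end AntiperiodicSixVertex

end

/-!
The proof is a separation of variables. For an arbitrary sequence of sites the entries of the
monodromy matrix satisfy the exchange relations of the six-vertex `R`-matrix (`mono_exchange`), and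
at the inhomogeneities there are two more facts: the quantum determinant is a scalar
(`mono_antisymm_row`), and entries in the same column of the monodromy matrices at `η_a / q` and
`η_a` annihilate each other (`mono_fusion_column`), because the Lax operator of the site `a` becomes
a rank-one antisymmetric projector at the first point and a permutation at the second.

Let `w h` be the state obtained from the reference state by applying multiples of `B(η_a)` for all
`a` with `h_a = 1`. The relations above show that `D(η_a)` and `C(η_a)` kill `w h` when `h_a = 0`,
so the transfer matrix `B + C` raises `h_a` at `η_a`, and lowers it at `η_a / q` by the quantum
determinant. The `w h` are joint eigenvectors of the `D(η_a / q)`, whose eigenvalues vanish exactly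
when `h_a = 1`; hence they are linearly independent, and form a basis.

The entries of the transfer matrix are Laurent polynomials determined by their values at the `N`
points `η_a q^{-h_a}`, so its action on the basis is known for every spectral parameter. The weight
`sovWeight` in front of the wave function absorbs the interpolation kernel
(`Generic.sovWeight_mul_lagrangeKernel`), and a vector is an eigenvector with eigenvalue `t` exactly
when its wave function satisfies one two-term equation for each configuration and each site
(`IsBaxter`). These equations connect all configurations, which gives simplicity; they are
compatible around the pair `h_a = 0, 1` exactly when `t(η_a) t(η_a / q) = a(η_a) d(η_a / q)`; and
they decouple for product wave functions, which gives the functions `Q`.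

Transposing the operators exchanges `B` and `C` and reverses the order of the sites, so the
statements about covectors are the same statements for the reversed chain, with the roles of
`a(η_a)` and `d(η_a / q)` exchanged.
-/

open scoped Matrix

noncomputable section

namespace AntiperiodicSixVertex

/-! ### Operators acting at one site -/

theorem siteOp_mulVec {N : ℕ} (n : Fin N) (X : Matrix (Fin 2) (Fin 2) ℂ) (v : Config N → ℂ)
    (s : Config N) :
    (siteOp n X *ᵥ v) s = ∑ k, X (s n) k * v (Function.update s n k) := by
  simp only [Matrix.mulVec, dotProduct, siteOp, Matrix.of_apply, ite_mul, zero_mul]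
  rw [← Finset.sum_filter]
  refine Finset.sum_bij' (fun s' _ => s' n) (fun k _ => Function.update s n k) ?_ ?_ ?_ ?_ ?_
  · simp
  · intro k _
    simp only [Finset.mem_filter, Finset.mem_univ, true_and]
    intro m hm
    rw [Function.update_of_ne hm]
  · intro s' hs'
    simp only [Finset.mem_filter, Finset.mem_univ, true_and] at hs'
    funext m
    by_cases hm : m = n
    · subst hm; simp
    · rw [Function.update_of_ne hm, hs' m hm]
  · simp
  · intro s' hs'
    simp only [Finset.mem_filter, Finset.mem_univ, true_and] at hs'
    congr 2
    funext m
    by_cases hm : m = n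
    · subst hm; simp
    · rw [Function.update_of_ne hm, hs' m hm]

theorem siteOp_mul {N : ℕ} (n : Fin N) (X Y : Matrix (Fin 2) (Fin 2) ℂ) :
    siteOp n X * siteOp n Y = siteOp n (X * Y) := by
  apply Matrix.mulVec_injective
  funext v s
  simp only [← Matrix.mulVec_mulVec, siteOp_mulVec, Function.update_self, Function.update_idem,
    Matrix.mul_apply, Fin.sum_univ_two]
  ring

theorem siteOp_commute {N : ℕ} {n m : Fin N} (hnm : n ≠ m) (X Y : Matrix (Fin 2) (Fin 2) ℂ) :
    Commute (siteOp n X) (siteOp m Y) := by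
  apply Matrix.mulVec_injective
  funext v s
  simp only [← Matrix.mulVec_mulVec, siteOp_mulVec, Function.update_of_ne hnm,
    Function.update_of_ne hnm.symm, Fin.sum_univ_two,
    fun i j : Fin 2 => Function.update_comm hnm i j s]
  ring

theorem siteOp_add {N : ℕ} (n : Fin N) (X Y : Matrix (Fin 2) (Fin 2) ℂ) :
    siteOp n (X + Y) = siteOp n X + siteOp n Y := by
  ext s s'
  simp only [siteOp, Matrix.of_apply, Matrix.add_apply]
  split_ifs <;> simp

theorem siteOp_smul {N : ℕ} (n : Fin N) (c : ℂ) (X : Matrix (Fin 2) (Fin 2) ℂ) :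
    siteOp n (c • X) = c • siteOp n X := by
  ext s s'
  simp only [siteOp, Matrix.of_apply, Matrix.smul_apply]
  split_ifs <;> simp

theorem siteOp_zero {N : ℕ} (n : Fin N) : siteOp n 0 = 0 := by
  ext s s'
  simp [siteOp]

theorem siteOp_one {N : ℕ} (n : Fin N) : siteOp n 1 = 1 := by
  apply Matrix.mulVec_injective
  funext v s
  simp [siteOp_mulVec, Matrix.one_apply]

theorem siteOp_transpose {N : ℕ} (n : Fin N) (X : Matrix (Fin 2) (Fin 2) ℂ) :
    (siteOp n X)ᵀ = siteOp n Xᵀ := by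
  ext s s'
  simp only [siteOp, Matrix.transpose_apply, Matrix.of_apply, eq_comm]

/-! ### The monodromy matrix of an arbitrary sequence of sites -/

/-- The four `2 × 2` matrices whose actions at a site are the entries of its Lax operator. -/
def laxEntry (q l : ℂˣ) : Matrix (Fin 2) (Fin 2) (Matrix (Fin 2) (Fin 2) ℂ) :=
  !![!![(l : ℂ) * q - ((l : ℂ) * q)⁻¹, 0; 0, (l : ℂ) - (l : ℂ)⁻¹],
      !![0, 0; (q : ℂ) - (q : ℂ)⁻¹, 0];
    !![0, (q : ℂ) - (q : ℂ)⁻¹; 0, 0],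
      !![(l : ℂ) - (l : ℂ)⁻¹, 0; 0, (l : ℂ) * q - ((l : ℂ) * q)⁻¹]]

theorem lax_apply {N : ℕ} (q : ℂˣ) (n : Fin N) (l : ℂˣ) (i j : Fin 2) :
    lax q n l i j = siteOp n (laxEntry q l i j) := by
  fin_cases i <;> fin_cases j <;> simp only [lax, laxEntry, Fin.zero_eta, Fin.mk_one,
    Matrix.of_apply, Matrix.cons_val', Matrix.cons_val_zero, Matrix.cons_val_one,
    Matrix.cons_val_fin_one] <;> congr 1 <;> ext i j <;> fin_cases i <;> fin_cases j <;>
    simp [sigmaZ, sigmaMinus, sigmaPlus, xPlus, xMinus] <;> ring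

/-- The ordered product of the Lax operators along a list of sites; the monodromy matrix of the
chain is the case of the list `N, …, 1`. Reading the list backwards transposes the operators,
which is what relates covectors to vectors. -/
def mono {N : ℕ} (q : ℂˣ) (η : Fin N → ℂˣ) (s : List (Fin N)) (l : ℂˣ) :
    Matrix (Fin 2) (Fin 2) (Op N) :=
  (s.map fun n => lax q n (l / η n)).prod

theorem monodromy_eq_mono {N : ℕ} (q : ℂˣ) (η : Fin N → ℂˣ) (l : ℂˣ) :
    monodromy q η l = mono q η (List.finRange N).reverse l := by
  rw [monodromy, mono, List.ofFn_eq_map, List.map_reverse]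

theorem mono_cons_apply {N : ℕ} (q : ℂˣ) (η : Fin N → ℂˣ) (n : Fin N) (s : List (Fin N)) (l : ℂˣ)
    (i j : Fin 2) :
    mono q η (n :: s) l i j =
      lax q n (l / η n) i 0 * mono q η s l 0 j + lax q n (l / η n) i 1 * mono q η s l 1 j := by
  simp [mono, Matrix.mul_apply, Fin.sum_univ_two]

theorem lax_commute_mono {N : ℕ} (q : ℂˣ) (η : Fin N → ℂˣ) {n : Fin N} {s : List (Fin N)}
    (hn : n ∉ s) (l m : ℂˣ) (i j i' j' : Fin 2) :
    Commute (lax q n l i j) (mono q η s m i' j') := by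
  induction s generalizing i' j' with
  | nil =>
    by_cases h : i' = j' <;> simp [mono, h]
  | cons k s ih =>
    rw [List.mem_cons, not_or] at hn
    rw [mono_cons_apply]
    have hk : ∀ i' j', Commute (lax q n l i j) (lax q k (m / η k) i' j') := fun i' j' => by
      rw [lax_apply, lax_apply]
      exact siteOp_commute hn.1 _ _
    exact ((hk _ _).mul_right (ih hn.2 _ _)).add_right ((hk _ _).mul_right (ih hn.2 _ _))

/-- Transposing the operators reverses the order of the sites and transposes the auxiliary space. -/
theorem mono_transpose {N : ℕ} (q : ℂˣ) (η : Fin N → ℂˣ) {s : List (Fin N)} (hs : s.Nodup)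
    (l : ℂˣ) (i j : Fin 2) :
    (mono q η s l i j)ᵀ = mono q η s.reverse l j i := by
  induction s generalizing i j with
  | nil =>
    by_cases h : i = j
    · subst h; simp [mono]
    · simp [mono, h, Ne.symm h]
  | cons n s ih =>
    rw [List.nodup_cons] at hs
    have hL : ∀ i j, (lax q n (l / η n) i j)ᵀ = lax q n (l / η n) j i := fun i j => by
      rw [lax_apply, lax_apply, siteOp_transpose]
      congr 1
      ext a b
      fin_cases i <;> fin_cases j <;> fin_cases a <;> fin_cases b <;> simp [laxEntry]
    have hR : mono q η (n :: s).reverse l j i =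
        mono q η s.reverse l j 0 * lax q n (l / η n) 0 i +
          mono q η s.reverse l j 1 * lax q n (l / η n) 1 i := by
      simp [mono, Matrix.mul_apply, Fin.sum_univ_two]
    rw [hR, mono_cons_apply, Matrix.transpose_add, Matrix.transpose_mul, Matrix.transpose_mul,
      ih hs.2, ih hs.2, hL, hL]

/-- Operators at different sites commute, so a product of two monodromy matrices with the same sites
is a product of pairs of Lax operators, one pair for each site. This reduces exchange, fusion and
determinant relations to a single site. -/
theorem mono_cons_mul_mono_cons {N : ℕ} (q : ℂˣ) (η : Fin N → ℂˣ) {n : Fin N} {s : List (Fin N)}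
    (hn : n ∉ s) (u v : ℂˣ) (i j k r : Fin 2) :
    mono q η (n :: s) u i k * mono q η (n :: s) v j r =
      ∑ p, ∑ o, (lax q n (u / η n) i p * lax q n (v / η n) j o) *
        (mono q η s u p k * mono q η s v o r) := by
  have hc : ∀ (a b c d : Fin 2) (X Y : Op N),
      (X * mono q η s u a b) * (lax q n (v / η n) c d * Y) =
        (X * lax q n (v / η n) c d) * (mono q η s u a b * Y) := fun a b c d X Y => by
    have h := (lax_commute_mono q η hn (v / η n) u c d a b).eq
    rw [mul_assoc, ← mul_assoc (mono q η s u a b), ← h]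
    simp only [mul_assoc]
  simp only [mono_cons_apply, Fin.sum_univ_two, add_mul, mul_add, hc]
  abel

/-! ### Exchange relations -/

/-- Entries of the six-vertex `R`-matrix that keep the pair `(i, j)`. -/
def rDiag (q w : ℂˣ) (i j : Fin 2) : ℂ :=
  if i = j then (w : ℂ) * q - ((w : ℂ) * q)⁻¹ else (w : ℂ) - (w : ℂ)⁻¹

/-- Entries of the six-vertex `R`-matrix that exchange `i` and `j`. -/
def rFlip (q : ℂˣ) (i j : Fin 2) : ℂ :=
  if i = j then 0 else (q : ℂ) - (q : ℂ)⁻¹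

theorem laxEntry_exchange (q l m : ℂˣ) (i j k r : Fin 2) :
    rDiag q (l / m) i j • (laxEntry q l i k * laxEntry q m j r) +
        rFlip q i j • (laxEntry q l j k * laxEntry q m i r) =
      rDiag q (l / m) k r • (laxEntry q m j r * laxEntry q l i k) +
        rFlip q k r • (laxEntry q m j k * laxEntry q l i r) := by
  have hq := q.ne_zero
  have hl := l.ne_zero
  have hm := m.ne_zero
  ext a b
  fin_cases i <;> fin_cases j <;> fin_cases k <;> fin_cases r <;> fin_cases a <;> fin_cases b <;>
    simp [laxEntry, rDiag, rFlip, -mul_eq_mul_left_iff, -mul_eq_mul_right_iff] <;> field_simp <;> ring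

theorem lax_exchange {N : ℕ} (q : ℂˣ) (n : Fin N) (l m : ℂˣ) (i j k r : Fin 2) :
    rDiag q (l / m) i j • (lax q n l i k * lax q n m j r) +
        rFlip q i j • (lax q n l j k * lax q n m i r) =
      rDiag q (l / m) k r • (lax q n m j r * lax q n l i k) +
        rFlip q k r • (lax q n m j k * lax q n l i r) := by
  simp only [lax_apply, siteOp_mul, ← siteOp_smul, ← siteOp_add]
  rw [laxEntry_exchange]

/-- The Yang–Baxter exchange relation `R T₁(l) T₂(m) = T₂(m) T₁(l) R`, in components. -/
theorem mono_exchange {N : ℕ} (q : ℂˣ) (η : Fin N → ℂˣ) {s : List (Fin N)} (hs : s.Nodup)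
    (l m : ℂˣ) (i j k r : Fin 2) :
    rDiag q (l / m) i j • (mono q η s l i k * mono q η s m j r) +
        rFlip q i j • (mono q η s l j k * mono q η s m i r) =
      rDiag q (l / m) k r • (mono q η s m j r * mono q η s l i k) +
        rFlip q k r • (mono q η s m j k * mono q η s l i r) := by
  induction s generalizing i j k r with
  | nil =>
    fin_cases i <;> fin_cases j <;> fin_cases k <;> fin_cases r <;>
      simp [mono, rDiag, rFlip]
  | cons n s ih =>
    rw [List.nodup_cons] at hs
    have hL := fun i j k r => lax_exchange q n (l / η n) (m / η n) i j k r
    rw [div_div_div_cancel_right] at hL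
    -- exchange the two Lax operators of the first site, then the two remaining products
    have hsum := mono_cons_mul_mono_cons q η hs.1
    have h1 : rDiag q (l / m) i j • (mono q η (n :: s) l i k * mono q η (n :: s) m j r) +
        rFlip q i j • (mono q η (n :: s) l j k * mono q η (n :: s) m i r) =
        ∑ p, ∑ o, (rDiag q (l / m) p o • (lax q n (m / η n) j o * lax q n (l / η n) i p) +
          rFlip q p o • (lax q n (m / η n) j p * lax q n (l / η n) i o)) *
            (mono q η s l p k * mono q η s m o r) := by
      simp only [hsum, ← hL, Fin.sum_univ_two, add_mul, smul_add, smul_mul_assoc]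
      abel
    have h2 : rDiag q (l / m) k r • (mono q η (n :: s) m j r * mono q η (n :: s) l i k) +
        rFlip q k r • (mono q η (n :: s) m j k * mono q η (n :: s) l i r) =
        ∑ p, ∑ o, (lax q n (m / η n) j o * lax q n (l / η n) i p) *
            (rDiag q (l / m) p o • (mono q η s l p k * mono q η s m o r) +
              rFlip q p o • (mono q η s l o k * mono q η s m p r)) := by
      simp only [hsum, ih hs.2, Fin.sum_univ_two, mul_add, smul_add, mul_smul_comm]
      abel
    rw [h1, h2]
    simp only [Fin.sum_univ_two, add_mul, mul_add, smul_mul_assoc, mul_smul_comm]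
    have hf : rFlip q 1 0 = rFlip q 0 1 := by simp [rFlip]
    have hf0 : rFlip q 0 0 = 0 := by simp [rFlip]
    have hf1 : rFlip q 1 1 = 0 := by simp [rFlip]
    simp only [hf, hf0, hf1, zero_smul]
    abel

/-! ### Fusion at the inhomogeneities and the quantum determinant -/

/-- The contribution of one site to the quantum determinant `-a(l) d(l/q)` of the chain. -/
def siteDet (q l : ℂˣ) : ℂ := ((l : ℂ) * q - ((l : ℂ) * q)⁻¹) * ((l : ℂ) / q - (q : ℂ) / l)

/-- The sign of the pair `(k, r)` in a `2 × 2` determinant. -/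
def pairSign (k r : Fin 2) : ℂ := (r : ℕ) - (k : ℕ)

theorem lax_antisymm_row {N : ℕ} (q : ℂˣ) (n : Fin N) (l : ℂˣ) (k r : Fin 2) :
    lax q n (l / q) 0 k * lax q n l 1 r - lax q n (l / q) 1 k * lax q n l 0 r =
      (pairSign k r * siteDet q l) • (1 : Op N) := by
  have hq := q.ne_zero
  have hl := l.ne_zero
  rw [sub_eq_add_neg, ← neg_one_smul ℂ, ← siteOp_one n]
  simp only [lax_apply, siteOp_mul, ← siteOp_smul, ← siteOp_add]
  congr 1
  ext a b
  fin_cases k <;> fin_cases r <;> fin_cases a <;> fin_cases b <;>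
    simp [laxEntry, siteDet, pairSign, -mul_eq_mul_left_iff, -mul_eq_mul_right_iff] <;> field_simp <;> ring

/-- The quantum determinant: `T(l/q) ⊗ T(l)` restricted to antisymmetric row pairs is a scalar. -/
theorem mono_antisymm_row {N : ℕ} (q : ℂˣ) (η : Fin N → ℂˣ) {s : List (Fin N)} (hs : s.Nodup)
    (l : ℂˣ) (k r : Fin 2) :
    mono q η s (l / q) 0 k * mono q η s l 1 r - mono q η s (l / q) 1 k * mono q η s l 0 r =
      (pairSign k r * (s.map fun n => siteDet q (l / η n)).prod) • (1 : Op N) := by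
  induction s generalizing k r with
  | nil => fin_cases k <;> fin_cases r <;> simp [mono, pairSign]
  | cons n s ih =>
    rw [List.nodup_cons] at hs
    have hL := lax_antisymm_row q n (l / η n)
    rw [div_right_comm] at hL
    rw [mono_cons_mul_mono_cons q η hs.1, mono_cons_mul_mono_cons q η hs.1]
    simp only [← Finset.sum_sub_distrib, ← sub_mul, hL]
    simp only [Fin.sum_univ_two, pairSign, Fin.val_zero, Fin.val_one, Nat.cast_zero, Nat.cast_one,
      sub_self, zero_mul, zero_smul, sub_zero, zero_sub, one_mul, neg_mul, neg_smul,
      smul_mul_assoc]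
    rw [neg_zero, zero_add, add_zero, ← sub_eq_add_neg, ← smul_sub, ih hs.2, smul_smul, List.map_cons,
      List.prod_cons]
    congr 1
    simp only [pairSign]
    ring

theorem lax_fusion_column {N : ℕ} (q : ℂˣ) (n : Fin N) (i j : Fin 2) :
    (∀ k, lax q n (1 / q) i k * lax q n 1 j k = 0) ∧
      lax q n (1 / q) i 1 * lax q n 1 j 0 = -(lax q n (1 / q) i 0 * lax q n 1 j 1) := by
  have hq := q.ne_zero
  have h0 := siteOp_zero n
  refine ⟨fun k => ?_, ?_⟩
  · rw [lax_apply, lax_apply, siteOp_mul, ← h0]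
    congr 1
    ext a b
    fin_cases i <;> fin_cases j <;> fin_cases k <;> fin_cases a <;> fin_cases b <;>
      simp [laxEntry]
  · rw [eq_neg_iff_add_eq_zero]
    simp only [lax_apply, siteOp_mul, ← siteOp_add, ← h0]
    congr 1
    ext a b
    fin_cases i <;> fin_cases j <;> fin_cases a <;> fin_cases b <;>
      simp [laxEntry] <;> ring

/-- At an inhomogeneity the Lax operator degenerates to a permutation and, at the point shifted by
`q`, to a projector on antisymmetric pairs; hence entries in the same column annihilate. -/
theorem mono_fusion_column {N : ℕ} (q : ℂˣ) (η : Fin N → ℂˣ) {s : List (Fin N)} (hs : s.Nodup)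
    {a : Fin N} (ha : a ∈ s) (i j k : Fin 2) :
    mono q η s (η a / q) i k * mono q η s (η a) j k = 0 := by
  induction s generalizing i j k with
  | nil => simp at ha
  | cons n s ih =>
    rw [List.nodup_cons] at hs
    rw [mono_cons_mul_mono_cons q η hs.1]
    rcases List.mem_cons.1 ha with rfl | ha
    · obtain ⟨h0, h1⟩ := lax_fusion_column q a i j
      have hr := mono_antisymm_row q η hs.2 (η a) k k
      rw [pairSign, sub_self, zero_mul, zero_smul] at hr
      rw [div_right_comm, div_self']
      -- the pair of Lax operators at `a` antisymmetrizes the rows of the remaining product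
      simp only [Fin.sum_univ_two, h0, h1, zero_mul, zero_add, add_zero, neg_mul,
        ← sub_eq_add_neg, ← mul_sub, hr, mul_zero]
    · simp only [ih hs.2 ha, mul_zero, Finset.sum_const_zero]

/-! ### The separated states -/

/-- Genericity of the inhomogeneities: the `2 N` points `η_a`, `η_a / q` have distinct squares. -/
structure Generic {N : ℕ} (q : ℂˣ) (η : Fin N → ℂˣ) : Prop where
  sq_ne : ∀ a b, a ≠ b → (η a : ℂ) ^ 2 ≠ (η b : ℂ) ^ 2
  sq_ne_shift : ∀ a b, (η a : ℂ) ^ 2 ≠ (q : ℂ) ^ 2 * (η b : ℂ) ^ 2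

theorem sub_inv_ne_zero {w : ℂ} (h0 : w ≠ 0) (hw : w ^ 2 ≠ 1) : w - w⁻¹ ≠ 0 := by
  intro h
  apply hw
  rw [sub_eq_zero] at h
  rw [sq]
  nth_rewrite 2 [h]
  exact mul_inv_cancel₀ h0

theorem rDiag_ne_zero (q w : ℂˣ) {i j : Fin 2} (hij : i ≠ j) (hw : (w : ℂ) ^ 2 ≠ 1) :
    rDiag q w i j ≠ 0 := by
  rw [rDiag, if_neg hij]
  exact sub_inv_ne_zero w.ne_zero hw

theorem rDiag_self_ne_zero (q w : ℂˣ) (i : Fin 2) (hw : ((w : ℂ) * q) ^ 2 ≠ 1) :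
    rDiag q w i i ≠ 0 := by
  rw [rDiag, if_pos rfl]
  exact sub_inv_ne_zero (mul_ne_zero w.ne_zero q.ne_zero) hw

theorem config_induction {N : ℕ} {P : Config N → Prop} (h0 : P 0)
    (hstep : ∀ h a, h a = 0 → P h → P (Function.update h a 1)) (h : Config N) : P h := by
  classical
  have key : ∀ S : Finset (Fin N), P fun a => if a ∈ S then 1 else 0 := by
    intro S
    induction S using Finset.induction_on with
    | empty => exact h0
    | insert a S ha ih =>
      have h1 := hstep _ a (by simp [ha]) ih
      convert h1 using 1
      funext b
      by_cases hb : b = a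
      · subst hb; simp
      · simp [hb]
  convert key (Finset.univ.filter fun a => h a = 1) using 1
  funext a
  have : h a = 0 ∨ h a = 1 := by omega
  rcases this with h | h <;> simp [h]

/-- The family of states obtained from the reference state by applying, at most once for each `a`,
the operator `γ_a B(η_a)` of the sequence of sites `s`. -/
structure IsSovFamily {N : ℕ} (q : ℂˣ) (η : Fin N → ℂˣ) (s : List (Fin N)) (γ : Fin N → ℂ)
    (w : Config N → Config N → ℂ) : Prop where
  init : ∃ c : ℂ, c ≠ 0 ∧ w 0 = c • refState N
  step : ∀ h a, h a = 0 → w (Function.update h a 1) = γ a • (mono q η s (η a) 0 1 *ᵥ w h)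

theorem mono_B_commute {N : ℕ} (q : ℂˣ) (η : Fin N → ℂˣ) {s : List (Fin N)} (hs : s.Nodup)
    {l m : ℂˣ} (h : (((l / m : ℂˣ) : ℂ) * q) ^ 2 ≠ 1) :
    Commute (mono q η s l 0 1) (mono q η s m 0 1) := by
  have h1 := mono_exchange q η hs l m 0 0 1 1
  have h2 : rDiag q (l / m) 0 0 = rDiag q (l / m) 1 1 := by simp [rDiag]
  simp only [rFlip, if_true, zero_smul, add_zero, ← h2] at h1
  exact smul_right_injective _ (rDiag_self_ne_zero q _ 0 h) h1

theorem mono_D_mul_B {N : ℕ} (q : ℂˣ) (η : Fin N → ℂˣ) {s : List (Fin N)} (hs : s.Nodup)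
    (l m : ℂˣ) :
    rDiag q (l / m) 1 0 • (mono q η s l 1 1 * mono q η s m 0 1) =
      rDiag q (l / m) 1 1 • (mono q η s m 0 1 * mono q η s l 1 1) -
        rFlip q 1 0 • (mono q η s l 0 1 * mono q η s m 1 1) := by
  have h1 := mono_exchange q η hs l m 1 0 1 1
  have h2 : rFlip q 1 1 = 0 := by simp [rFlip]
  rw [h2, zero_smul, add_zero] at h1
  exact eq_sub_of_add_eq h1

theorem mono_C_mul_B {N : ℕ} (q : ℂˣ) (η : Fin N → ℂˣ) {s : List (Fin N)} (hs : s.Nodup)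
    (l m : ℂˣ) :
    rDiag q (l / m) 1 0 • (mono q η s l 1 0 * mono q η s m 0 1) =
      rDiag q (l / m) 0 1 • (mono q η s m 0 1 * mono q η s l 1 0) +
        rFlip q 0 1 • (mono q η s m 0 0 * mono q η s l 1 1) -
        rFlip q 1 0 • (mono q η s l 0 0 * mono q η s m 1 1) :=
  eq_sub_of_add_eq (mono_exchange q η hs l m 1 0 0 1)

theorem lax_mulVec_refState {N : ℕ} (q : ℂˣ) (n : Fin N) (l : ℂˣ) :
    lax q n l 1 0 *ᵥ refState N = 0 ∧
      lax q n l 1 1 *ᵥ refState N = ((l : ℂ) - (l : ℂ)⁻¹) • refState N := by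
  have h1 : ∀ c : Config N, c n ≠ 0 → refState N c = 0 := fun c hc => by
    rw [refState, Pi.single_eq_of_ne]
    rintro rfl
    exact hc rfl
  constructor
  · funext c
    rw [lax_apply, siteOp_mulVec, Fin.sum_univ_two, h1 (Function.update c n 1) (by simp)]
    simp [laxEntry]
    left
    rcases (show c n = 0 ∨ c n = 1 by omega) with h' | h' <;> simp [h']
  · funext c
    rw [lax_apply, siteOp_mulVec, Fin.sum_univ_two, h1 (Function.update c n 1) (by simp)]
    rcases (show c n = 0 ∨ c n = 1 by omega) with h' | h'
    · have : Function.update c n 0 = c := by rw [← h', Function.update_eq_self]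
      simp [laxEntry, h', this]
    · simp [laxEntry, h', h1 c (by simp [h'])]

theorem mono_mulVec_refState {N : ℕ} (q : ℂˣ) (η : Fin N → ℂˣ) {s : List (Fin N)} (hs : s.Nodup)
    (l : ℂˣ) :
    mono q η s l 1 0 *ᵥ refState N = 0 ∧
      mono q η s l 1 1 *ᵥ refState N =
        (s.map fun n => ((l : ℂ) / η n - (η n : ℂ) / l)).prod • refState N := by
  induction s with
  | nil => simp [mono]
  | cons n s ih =>
    rw [List.nodup_cons] at hs
    obtain ⟨h0, h1⟩ := ih hs.2
    obtain ⟨g0, g1⟩ := lax_mulVec_refState q n (l / η n)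
    have hc := fun j => (lax_commute_mono q η hs.1 (l / η n) l 1 0 0 j).eq
    simp only [mono_cons_apply, hc, Matrix.add_mulVec, ← Matrix.mulVec_mulVec, g0, h0, h1,
      Matrix.mulVec_zero, Matrix.mulVec_smul, g1, smul_smul, zero_add, List.map_cons,
      List.prod_cons, true_and]
    rw [mul_comm]
    congr 2
    rw [Units.val_div_eq_div_val, inv_div]

section Family

variable {N : ℕ} {q : ℂˣ} {η : Fin N → ℂˣ} {s : List (Fin N)} {γ : Fin N → ℂ}
  {w : Config N → Config N → ℂ}

theorem div_sq_ne_one {l m : ℂˣ} (h : (l : ℂ) ^ 2 ≠ (m : ℂ) ^ 2) :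
    (((l / m : ℂˣ)) : ℂ) ^ 2 ≠ 1 := by
  rw [Units.val_div_eq_div_val, div_pow, Ne, div_eq_one_iff_eq (pow_ne_zero 2 m.ne_zero)]
  exact h

/-- `D(η_a)` and `C(η_a)` annihilate the separated states with `h_a = 0`: both annihilate the
reference state, and this survives the exchange with `B(η_b)`, `b ≠ a`. -/
theorem IsSovFamily.annihilate (hw : IsSovFamily q η s γ w) (hg : Generic q η) (hs : s.Nodup)
    (hmem : ∀ a, a ∈ s) (h : Config N) :
    ∀ a, h a = 0 → mono q η s (η a) 1 1 *ᵥ w h = 0 ∧ mono q η s (η a) 1 0 *ᵥ w h = 0 := by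
  induction h using config_induction with
  | h0 =>
    intro a _
    obtain ⟨c, -, hc⟩ := hw.init
    obtain ⟨h0, h1⟩ := mono_mulVec_refState q η hs (η a)
    have hz : (s.map fun n => ((η a : ℂ) / η n - (η n : ℂ) / η a)).prod = 0 := by
      apply List.prod_eq_zero
      rw [List.mem_map]
      exact ⟨a, hmem a, sub_self _⟩
    rw [hz, zero_smul] at h1
    rw [hc, Matrix.mulVec_smul, Matrix.mulVec_smul, h0, h1, smul_zero]
    exact ⟨rfl, rfl⟩
  | hstep h b hb ih =>
    intro a ha
    have hab : a ≠ b := by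
      rintro rfl
      simp at ha
    rw [Function.update_of_ne hab] at ha
    obtain ⟨hD, hC⟩ := ih a ha
    obtain ⟨hD', -⟩ := ih b hb
    have hr := rDiag_ne_zero q (η a / η b) one_ne_zero (div_sq_ne_one (hg.sq_ne a b hab))
    have e1 := congrArg (· *ᵥ w h) (mono_D_mul_B q η hs (η a) (η b))
    have e2 := congrArg (· *ᵥ w h) (mono_C_mul_B q η hs (η a) (η b))
    simp only [Matrix.smul_mulVec, Matrix.sub_mulVec, Matrix.add_mulVec, ← Matrix.mulVec_mulVec,
      hD, hD', hC, Matrix.mulVec_zero, smul_zero, sub_zero, add_zero] at e1 e2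
    rw [hw.step h b hb, Matrix.mulVec_smul, Matrix.mulVec_smul,
      (smul_eq_zero.1 e1).resolve_left hr, (smul_eq_zero.1 e2).resolve_left hr, smul_zero]
    exact ⟨rfl, rfl⟩

/-- At `η_a` the transfer matrix raises `h_a` from `0` to `1`. -/
theorem IsSovFamily.transfer_raise (hw : IsSovFamily q η s γ w) (hg : Generic q η) (hs : s.Nodup)
    (hmem : ∀ a, a ∈ s) (hγ : ∀ a, γ a ≠ 0) (h : Config N) (a : Fin N) (ha : h a = 0) :
    (mono q η s (η a) 0 1 + mono q η s (η a) 1 0) *ᵥ w h =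
      (γ a)⁻¹ • w (Function.update h a 1) := by
  rw [Matrix.add_mulVec, (hw.annihilate hg hs hmem h a ha).2, add_zero, hw.step h a ha, smul_smul,
    inv_mul_cancel₀ (hγ a), one_smul]

/-- At `η_a / q` the transfer matrix lowers `h_a` from `1` to `0`, by the quantum determinant. -/
theorem IsSovFamily.transfer_lower (hw : IsSovFamily q η s γ w) (hg : Generic q η) (hs : s.Nodup)
    (hmem : ∀ a, a ∈ s) (h : Config N) (a : Fin N) (ha : h a = 0) :
    (mono q η s (η a / q) 0 1 + mono q η s (η a / q) 1 0) *ᵥ w (Function.update h a 1) =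
      (-(γ a * (s.map fun n => siteDet q (η a / η n)).prod)) • w h := by
  have h1 := mono_antisymm_row q η hs (η a) 0 1
  have h2 := congrArg (· *ᵥ w h) h1
  have h3 : pairSign 0 1 = 1 := by simp [pairSign]
  simp only [h3, one_mul, Matrix.sub_mulVec, Matrix.smul_mulVec, Matrix.one_mulVec,
    ← Matrix.mulVec_mulVec, (hw.annihilate hg hs hmem h a ha).1, Matrix.mulVec_zero, zero_sub] at h2
  rw [hw.step h a ha, Matrix.mulVec_smul, Matrix.add_mulVec, Matrix.mulVec_mulVec,
    mono_fusion_column q η hs (hmem a), Matrix.zero_mulVec, zero_add, ← neg_eq_iff_eq_neg.2 h2.symm,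
    smul_neg, smul_smul, neg_smul]

/-- The states are joint eigenvectors of the operators `D(η_a / q)`, and the zero pattern of the
eigenvalues determines the state. -/
theorem IsSovFamily.exists_eigenvalue_D (hw : IsSovFamily q η s γ w) (hg : Generic q η)
    (hs : s.Nodup) (hmem : ∀ a, a ∈ s) (h : Config N) (a : Fin N) :
    ∃ κ : ℂ, mono q η s (η a / q) 1 1 *ᵥ w h = κ • w h ∧ (κ = 0 ↔ h a = 1) := by
  rcases (show h a = 0 ∨ h a = 1 by omega) with ha | ha
  · suffices H : h a = 0 → ∃ κ : ℂ, mono q η s (η a / q) 1 1 *ᵥ w h = κ • w h ∧ κ ≠ 0 by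
      obtain ⟨κ, h1, h2⟩ := H ha
      exact ⟨κ, h1, by simp [h2, ha]⟩
    have hne : ∀ b, ((η a / q : ℂˣ) : ℂ) ^ 2 ≠ (η b : ℂ) ^ 2 := fun b hab => by
      apply hg.sq_ne_shift a b
      rw [← hab, Units.val_div_eq_div_val, div_pow, mul_div_cancel₀]
      exact pow_ne_zero 2 q.ne_zero
    clear ha
    induction h using config_induction with
    | h0 =>
      intro _
      obtain ⟨c, -, hc⟩ := hw.init
      obtain ⟨-, h1⟩ := mono_mulVec_refState q η hs (η a / q)
      refine ⟨_, by rw [hc, Matrix.mulVec_smul, h1, smul_comm], ?_⟩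
      rw [Ne, List.prod_eq_zero_iff, List.mem_map]
      rintro ⟨b, -, hb⟩
      rw [← inv_div ((η a / q : ℂˣ) : ℂ), ← Units.val_div_eq_div_val] at hb
      exact sub_inv_ne_zero (Units.ne_zero _) (div_sq_ne_one (hne b)) hb
    | hstep h b hb ih =>
      intro ha
      have hab : a ≠ b := by
        rintro rfl
        simp at ha
      rw [Function.update_of_ne hab] at ha
      obtain ⟨κ, h1, h2⟩ := ih ha
      have hr := rDiag_ne_zero q (η a / q / η b) one_ne_zero (div_sq_ne_one (hne b))
      have e1 := congrArg (· *ᵥ w h) (mono_D_mul_B q η hs (η a / q) (η b))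
      simp only [Matrix.smul_mulVec, Matrix.sub_mulVec, ← Matrix.mulVec_mulVec, h1,
        (hw.annihilate hg hs hmem h b hb).1, Matrix.mulVec_zero, smul_zero, sub_zero,
        Matrix.mulVec_smul] at e1
      refine ⟨(rDiag q (η a / q / η b) 1 0)⁻¹ * (rDiag q (η a / q / η b) 1 1 * κ), ?_, ?_⟩
      · rw [hw.step h b hb, Matrix.mulVec_smul, smul_comm _ (γ b)]
        congr 1
        rw [mul_smul, mul_smul, ← e1, smul_smul, inv_mul_cancel₀ hr, one_smul]
      · refine mul_ne_zero (inv_ne_zero hr) (mul_ne_zero (rDiag_self_ne_zero q _ 1 ?_) h2)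
        have : ((η a / q / η b : ℂˣ) : ℂ) * q = ((η a / η b : ℂˣ) : ℂ) := by
          rw [← Units.val_mul, div_right_comm, div_mul_cancel]
        rw [this]
        exact div_sq_ne_one (hg.sq_ne a b hab)
  · refine ⟨0, ?_, by simp [ha]⟩
    have hu : h = Function.update (Function.update h a 0) a 1 := by
      rw [Function.update_idem, ← ha, Function.update_eq_self]
    rw [hu, hw.step _ a (by simp), Matrix.mulVec_smul, Matrix.mulVec_mulVec,
      mono_fusion_column q η hs (hmem a), Matrix.zero_mulVec, smul_zero, zero_smul]

/-- The lowering action leads from every state back to the reference state. -/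
theorem IsSovFamily.ne_zero (hw : IsSovFamily q η s γ w) (hg : Generic q η) (hs : s.Nodup)
    (hmem : ∀ a, a ∈ s) (hγ : ∀ a, γ a ≠ 0)
    (hdet : ∀ a, (s.map fun n => siteDet q (η a / η n)).prod ≠ 0) (h : Config N) : w h ≠ 0 := by
  induction h using config_induction with
  | h0 =>
    obtain ⟨c, hc0, hc⟩ := hw.init
    rw [hc]
    exact smul_ne_zero hc0 (by simp [refState])
  | hstep h a ha ih =>
    intro h0
    have h1 := hw.transfer_lower hg hs hmem h a ha
    rw [h0, Matrix.mulVec_zero] at h1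
    exact smul_ne_zero (neg_ne_zero.2 (mul_ne_zero (hγ a) (hdet a))) ih h1.symm

theorem IsSovFamily.linearIndependent (hw : IsSovFamily q η s γ w) (hg : Generic q η)
    (hs : s.Nodup) (hmem : ∀ a, a ∈ s) (hγ : ∀ a, γ a ≠ 0)
    (hdet : ∀ a, (s.map fun n => siteDet q (η a / η n)).prod ≠ 0) : LinearIndependent ℂ w := by
  choose κ hκ hκ0 using hw.exists_eigenvalue_D hg hs hmem
  have hprod : ∀ (L : List (Fin N)) (h : Config N),
      (L.map fun a => mono q η s (η a / q) 1 1).prod *ᵥ w h = (L.map (κ h)).prod • w h := by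
    intro L h
    induction L with
    | nil => simp
    | cons a L ih =>
      rw [List.map_cons, List.prod_cons, ← Matrix.mulVec_mulVec, ih, Matrix.mulVec_smul, hκ,
        smul_smul, List.map_cons, List.prod_cons, mul_comm]
  rw [Fintype.linearIndependent_iff]
  intro c hc h
  induction h using WellFoundedLT.induction with
  | ind h ih =>
    -- the product of the `D(η_a / q)` over the sites with `h_a = 0` kills all states not below `h`
    let L := (Finset.univ.filter fun a => h a = 0).toList
    have hsum := congrArg ((L.map fun a => mono q η s (η a / q) 1 1).prod *ᵥ ·) hc
    simp only [Matrix.mulVec_sum, Matrix.mulVec_smul, hprod, Matrix.mulVec_zero] at hsum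
    rw [Finset.sum_eq_single h] at hsum
    · rcases smul_eq_zero.1 hsum with h1 | h1
      · exact h1
      · exfalso
        rcases smul_eq_zero.1 h1 with h2 | h2
        · rw [List.prod_eq_zero_iff, List.mem_map] at h2
          obtain ⟨a, haL, ha⟩ := h2
          rw [hκ0] at ha
          simp [L, ha] at haL
        · exact hw.ne_zero hg hs hmem hγ hdet h h2
    · intro h' _ hne
      by_cases hle : h' ≤ h
      · rw [ih h' (lt_of_le_of_ne hle hne), zero_smul]
      · rw [Pi.le_def, not_forall] at hle
        obtain ⟨a, ha⟩ := hle
        have : (L.map (κ h')).prod = 0 := by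
          rw [List.prod_eq_zero_iff, List.mem_map]
          refine ⟨a, ?_, (hκ0 h' a).2 ?_⟩
          · simp only [L, Finset.mem_toList, Finset.mem_filter, Finset.mem_univ, true_and]
            omega
          · omega
        rw [this, zero_smul, smul_zero]
    · simp

end Family

/-! ### Laurent polynomials of fixed parity -/

/-- The functions `l ↦ l^{1-m} p(l²)` with `p` a polynomial of degree less than `m`, that is, the
Laurent polynomials with exponents `-(m-1), -(m-3), …, m-1`. Clearing denominators with `l ^ m`
gives the zero space for `m = 0`. -/
def parityClass (m : ℕ) : Submodule ℂ (ℂˣ → ℂ) where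
  carrier := {f | ∃ p ∈ Polynomial.degreeLT ℂ m, ∀ l : ℂˣ,
    f l * (l : ℂ) ^ m = l * p.eval ((l : ℂ) ^ 2)}
  add_mem' := by
    rintro f g ⟨p, hp, hf⟩ ⟨r, hr, hg⟩
    refine ⟨p + r, add_mem hp hr, fun l => ?_⟩
    rw [Pi.add_apply, add_mul, hf, hg, Polynomial.eval_add, mul_add]
  zero_mem' := ⟨0, zero_mem _, fun l => by simp⟩
  smul_mem' := by
    rintro c f ⟨p, hp, hf⟩
    refine ⟨c • p, Submodule.smul_mem _ _ hp, fun l => ?_⟩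
    rw [Pi.smul_apply, smul_mul_assoc, hf, Polynomial.eval_smul, mul_smul_comm]

theorem parityClass_linear_mul {m : ℕ} {f : ℂˣ → ℂ} (hf : f ∈ parityClass m) (c d : ℂ) :
    (fun l : ℂˣ => (c * l + d * (l : ℂ)⁻¹) * f l) ∈ parityClass (m + 1) := by
  obtain ⟨p, hp, h⟩ := hf
  rw [Polynomial.mem_degreeLT] at hp
  refine ⟨(Polynomial.C c * Polynomial.X + Polynomial.C d) * p, ?_, fun l => ?_⟩
  · rw [Polynomial.mem_degreeLT, Polynomial.degree_mul, add_comm, Nat.cast_add, Nat.cast_one]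
    rcases eq_or_ne p 0 with rfl | hp0
    · simp
    · rw [Polynomial.degree_eq_natDegree hp0] at hp ⊢
      refine lt_of_le_of_lt (add_le_add_right Polynomial.degree_linear_le _) ?_
      exact_mod_cast Nat.add_lt_add_right (by exact_mod_cast hp) 1
  · have hl := l.ne_zero
    have e : (c * l + d * (l : ℂ)⁻¹) * f l * (l : ℂ) ^ (m + 1) =
        (c * (l : ℂ) ^ 2 + d) * (f l * (l : ℂ) ^ m) := by
      rw [pow_succ]
      field_simp
    rw [e, h]
    simp
    ring

theorem parityClass_le_add_two (m : ℕ) : parityClass m ≤ parityClass (m + 2) := by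
  rintro f ⟨p, hp, h⟩
  rw [Polynomial.mem_degreeLT] at hp
  refine ⟨Polynomial.X * p, ?_, fun l => ?_⟩
  · rw [Polynomial.mem_degreeLT, Polynomial.degree_mul, Polynomial.degree_X, add_comm]
    rcases eq_or_ne p 0 with rfl | hp0
    · rw [Polynomial.degree_zero, WithBot.bot_add]
      exact WithBot.bot_lt_coe _
    · rw [Polynomial.degree_eq_natDegree hp0] at hp ⊢
      have : p.natDegree < m := by exact_mod_cast hp
      exact_mod_cast (by omega : p.natDegree + 1 < m + 2)
  · rw [pow_add, ← mul_assoc, h]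
    simp
    ring

theorem zpow_mem_parityClass {m : ℕ} {k : ℤ} (hk : |k| ≤ (m : ℤ) - 1) (hm : Even (k + m - 1)) :
    (fun l : ℂˣ => ((l ^ k : ℂˣ) : ℂ)) ∈ parityClass m := by
  obtain ⟨i, hi⟩ := hm
  rw [abs_le] at hk
  lift i to ℕ using by omega
  refine ⟨Polynomial.X ^ i, ?_, fun l => ?_⟩
  · rw [Polynomial.mem_degreeLT, Polynomial.degree_X_pow]
    exact_mod_cast (by omega : i < m)
  · rw [Polynomial.eval_pow, Polynomial.eval_X, ← pow_mul, ← pow_succ', ← Units.val_pow_eq_pow_val,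
      ← Units.val_pow_eq_pow_val, ← Units.val_mul, ← zpow_natCast, ← zpow_natCast, ← zpow_add]
    congr 2
    push_cast
    omega

theorem eval₂_eq_sum (p : LaurentPolynomial ℂ) (l : ℂˣ) :
    LaurentPolynomial.eval₂ (RingHom.id ℂ) l p =
      ∑ k ∈ p.coeff.support, p.coeff k * ((l ^ k : ℂˣ) : ℂ) := by
  have h : p = ∑ k ∈ p.coeff.support, LaurentPolynomial.C (p.coeff k) * LaurentPolynomial.T k := by
    ext k
    simp only [← LaurentPolynomial.single_eq_C_mul_T, AddMonoidAlgebra.coeff_sum,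
      AddMonoidAlgebra.coeff_single, Finsupp.finsetSum_apply, Finsupp.single_apply]
    simp
  conv_lhs => rw [h]
  simp only [map_sum, map_mul, LaurentPolynomial.eval₂_C, LaurentPolynomial.eval₂_T,
    RingHom.id_apply]

theorem laurentClass_eq_parityClass {N : ℕ} (hN : 1 ≤ N) : laurentClass N = parityClass N := by
  ext t
  constructor
  · rintro ⟨⟨p, hp, ht⟩, hodd, heven⟩
    -- averaging over `l ↦ -l` removes the exponents of the wrong parity
    obtain ⟨ε, hε, hεN⟩ : ∃ ε : ℂ, (∀ l, t l = ε * t (-l)) ∧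
        ((Odd N ∧ ε = 1) ∨ (Even N ∧ ε = -1)) := by
      rcases Nat.even_or_odd N with h | h
      · exact ⟨-1, fun l => by rw [heven h l]; ring, Or.inr ⟨h, rfl⟩⟩
      · exact ⟨1, fun l => by rw [hodd h l]; ring, Or.inl ⟨h, rfl⟩⟩
    have h : t = ∑ k ∈ p.coeff.support, p.coeff k •
        fun l : ℂˣ => (((l ^ k : ℂˣ) : ℂ) + ε * (((-l) ^ k : ℂˣ) : ℂ)) / 2 := by
      funext l
      have h1 : t l = (t l + ε * t (-l)) / 2 := by rw [← hε]; ring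
      rw [h1, ht, ht, eval₂_eq_sum, eval₂_eq_sum, Finset.sum_apply, Finset.mul_sum,
        ← Finset.sum_add_distrib, Finset.sum_div]
      refine Finset.sum_congr rfl fun k _ => ?_
      rw [Pi.smul_apply, smul_eq_mul]
      ring
    rw [h]
    refine Submodule.sum_mem _ fun k hk => Submodule.smul_mem _ _ ?_
    by_cases hpar : Even (k + N - 1)
    · convert zpow_mem_parityClass (hp k hk) hpar using 2 with l
      rcases hεN with ⟨hN, rfl⟩ | ⟨hN, rfl⟩
      · rw [Even.neg_zpow (by grind)]; ring
      · rw [Odd.neg_zpow (by grind), Units.val_neg]; ring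
    · convert (parityClass N).zero_mem using 1
      funext l
      rcases hεN with ⟨hN, rfl⟩ | ⟨hN, rfl⟩
      · rw [Odd.neg_zpow (by grind), Units.val_neg, Pi.zero_apply]; ring
      · rw [Even.neg_zpow (by grind), Pi.zero_apply]; ring
  · rintro ⟨p, hp, ht⟩
    rw [Polynomial.mem_degreeLT] at hp
    have hnd : p.natDegree < N := by
      rcases eq_or_ne p 0 with rfl | hp0
      · rw [Polynomial.natDegree_zero]; exact hN
      · exact (Polynomial.natDegree_lt_iff_degree_lt hp0).2 hp
    have hpow : ∀ l : ℂˣ, (l : ℂ) ^ N ≠ 0 := fun l => pow_ne_zero N l.ne_zero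
    refine ⟨⟨∑ i ∈ Finset.range N, LaurentPolynomial.C (p.coeff i) *
      LaurentPolynomial.T (2 * i + 1 - N), ?_, fun l => ?_⟩, fun hN l => ?_, fun hN l => ?_⟩
    · intro k hk
      rw [Finsupp.mem_support_iff, AddMonoidAlgebra.coeff_sum, Finsupp.finsetSum_apply] at hk
      obtain ⟨i, hi, hik⟩ := Finset.exists_ne_zero_of_sum_ne_zero hk
      rw [← LaurentPolynomial.single_eq_C_mul_T, AddMonoidAlgebra.coeff_single,
        Finsupp.single_apply] at hik
      have hk' : (2 * i + 1 - N : ℤ) = k := by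
        by_contra hne
        rw [if_neg hne] at hik
        exact hik rfl
      rw [Finset.mem_range] at hi
      rw [abs_le]
      omega
    · apply mul_right_cancel₀ (hpow l)
      rw [ht, Polynomial.eval_eq_sum_range' hnd, map_sum, Finset.mul_sum, Finset.sum_mul]
      refine Finset.sum_congr rfl fun i _ => ?_
      rw [map_mul, LaurentPolynomial.eval₂_C, LaurentPolynomial.eval₂_T, RingHom.id_apply,
        mul_assoc, mul_left_comm]
      congr 1
      rw [← pow_mul, ← pow_succ', ← Units.val_pow_eq_pow_val, ← Units.val_pow_eq_pow_val,
        ← Units.val_mul, ← zpow_natCast, ← zpow_natCast, ← zpow_add]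
      congr 2
      push_cast
      ring
    · apply mul_right_cancel₀ (hpow (-l))
      rw [ht, Units.val_neg, hN.neg_pow, neg_sq, mul_neg, ht, neg_mul]
    · apply mul_right_cancel₀ (hpow (-l))
      rw [ht, Units.val_neg, hN.neg_pow, neg_sq, neg_mul, neg_mul, ht]

theorem lax_entry_linear {N : ℕ} (q : ℂˣ) (n : Fin N) (e : ℂˣ) (i j : Fin 2) (x z : Config N) :
    ∃ c d : ℂ, ∀ l : ℂˣ, lax q n (l / e) i j x z =
      if i = j then c * l + d * (l : ℂ)⁻¹ else c := by
  by_cases hs : ∀ m, m ≠ n → x m = z m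
  · have h : ∀ l, lax q n (l / e) i j x z = laxEntry q (l / e) i j (x n) (z n) := fun l => by
      rw [lax_apply, siteOp, Matrix.of_apply, if_pos hs]
    simp only [h]
    generalize x n = a
    generalize z n = b
    have h0 : ∃ c d : ℂ, ∀ l : ℂˣ, (0 : ℂ) = c * l + d * (l : ℂ)⁻¹ := ⟨0, 0, by simp⟩
    have h1 : ∃ c d : ℂ, ∀ l : ℂˣ, (l : ℂ) / e - e / l = c * l + d * (l : ℂ)⁻¹ :=
      ⟨(e : ℂ)⁻¹, -e, fun l => by ring⟩
    have h2 : ∃ c d : ℂ, ∀ l : ℂˣ, (l : ℂ) / e * q - (q : ℂ)⁻¹ * (e / l) =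
        c * l + d * (l : ℂ)⁻¹ :=
      ⟨(e : ℂ)⁻¹ * q, -(q : ℂ)⁻¹ * e, fun l => by ring⟩
    fin_cases i <;> fin_cases j <;> fin_cases a <;> fin_cases b <;>
      simp [laxEntry, Units.val_div_eq_div_val] <;> assumption
  · refine ⟨0, 0, fun l => ?_⟩
    rw [lax_apply, siteOp, Matrix.of_apply, if_neg hs]
    simp

/-- Diagonal entries of the monodromy matrix have degree and parity given by the number of sites,
off-diagonal entries one less. -/
theorem mono_mem_parityClass {N : ℕ} (q : ℂˣ) (η : Fin N → ℂˣ) (s : List (Fin N)) (i j : Fin 2)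
    (x y : Config N) :
    (fun l => mono q η s l i j x y) ∈ parityClass (s.length + if i = j then 1 else 0) := by
  induction s generalizing i j x with
  | nil =>
    by_cases hij : i = j
    · refine ⟨Polynomial.C ((1 : Op N) x y), ?_, fun l => ?_⟩
      · rw [if_pos hij, Polynomial.mem_degreeLT]
        refine lt_of_le_of_lt Polynomial.degree_C_le ?_
        simp
      · simp [mono, hij, mul_comm]
    · refine ⟨0, zero_mem _, fun l => ?_⟩
      simp [mono, hij]
  | cons n s ih =>
    have key : ∀ p, (fun l => (lax q n (l / η n) i p * mono q η s l p j) x y) ∈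
        parityClass ((n :: s).length + if i = j then 1 else 0) := by
      intro p
      have hsum : (fun l => (lax q n (l / η n) i p * mono q η s l p j) x y) =
          ∑ z, fun l => lax q n (l / η n) i p x z * mono q η s l p j z y := by
        funext l
        rw [Matrix.mul_apply, Finset.sum_apply]
      rw [hsum]
      refine Submodule.sum_mem _ fun z _ => ?_
      obtain ⟨c, d, h⟩ := lax_entry_linear q n (η n) i p x z
      simp only [h]
      have hz := ih p j z
      by_cases hip : i = p
      · subst hip
        simp only [if_true, List.length_cons]
        rw [Nat.add_right_comm]
        exact parityClass_linear_mul hz c d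
      · simp only [if_neg hip]
        have hc := Submodule.smul_mem _ c hz
        by_cases hij : i = j
        · subst hij
          rw [if_neg (Ne.symm hip), add_zero] at hc
          rw [if_pos rfl, List.length_cons, add_assoc]
          exact parityClass_le_add_two _ hc
        · have hpj : p = j := by omega
          rw [if_pos hpj] at hc
          rw [if_neg hij, List.length_cons, add_zero]
          exact hc
    have hadd : (fun l => mono q η (n :: s) l i j x y) =
        (fun l => (lax q n (l / η n) i 0 * mono q η s l 0 j) x y) +
          fun l => (lax q n (l / η n) i 1 * mono q η s l 1 j) x y := by
      funext l
      rw [mono_cons_apply]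
      rfl
    rw [hadd]
    exact add_mem (key 0) (key 1)

/-! ### Lagrange interpolation -/

/-- The interpolation kernel `(y_a / l)^{N-1} ∏_{b ≠ a} (l² - y_b²) / (y_a² - y_b²)`. -/
def lagrangeKernel {N : ℕ} (y : Fin N → ℂˣ) (a : Fin N) (l : ℂˣ) : ℂ :=
  (y a : ℂ) ^ (N - 1) / (l : ℂ) ^ (N - 1) *
    ∏ b ∈ Finset.univ.erase a, ((l : ℂ) ^ 2 - (y b : ℂ) ^ 2) / ((y a : ℂ) ^ 2 - (y b : ℂ) ^ 2)

theorem parityClass_interpolation {N : ℕ} (hN : 1 ≤ N) {f : ℂˣ → ℂ} (hf : f ∈ parityClass N)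
    {y : Fin N → ℂˣ} (hy : Function.Injective fun a => (y a : ℂ) ^ 2) (l : ℂˣ) :
    f l = ∑ a, lagrangeKernel y a l * f (y a) := by
  obtain ⟨p, hp, h⟩ := hf
  rw [Polynomial.mem_degreeLT] at hp
  have h' : ∀ l : ℂˣ, p.eval ((l : ℂ) ^ 2) = f l * (l : ℂ) ^ (N - 1) := fun l => by
    apply mul_left_cancel₀ l.ne_zero
    rw [← h, mul_left_comm, ← pow_succ', Nat.sub_add_cancel hN]
  have hi := Lagrange.eq_interpolate (s := Finset.univ) (v := fun a => (y a : ℂ) ^ 2) (f := p)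
    hy.injOn (by simpa using hp)
  have hpow := pow_ne_zero (N - 1) l.ne_zero
  apply mul_right_cancel₀ hpow
  rw [← h', hi, Lagrange.interpolate_apply, Polynomial.eval_finsetSum, Finset.sum_mul]
  refine Finset.sum_congr rfl fun a _ => ?_
  rw [Polynomial.eval_mul, Polynomial.eval_C, h', Lagrange.basis, Polynomial.eval_prod,
    lagrangeKernel]
  have hb : ∀ b, Polynomial.eval ((l : ℂ) ^ 2)
      (Lagrange.basisDivisor ((y a : ℂ) ^ 2) ((y b : ℂ) ^ 2)) =
        ((l : ℂ) ^ 2 - (y b : ℂ) ^ 2) / ((y a : ℂ) ^ 2 - (y b : ℂ) ^ 2) := fun b => by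
    simp [Lagrange.basisDivisor, div_eq_inv_mul]
  simp only [hb]
  field_simp

theorem lagrangeKernel_self {N : ℕ} {y : Fin N → ℂˣ}
    (hy : Function.Injective fun a => (y a : ℂ) ^ 2) (a : Fin N) :
    lagrangeKernel y a (y a) = 1 := by
  rw [lagrangeKernel, div_self (pow_ne_zero _ (y a).ne_zero), one_mul]
  refine Finset.prod_eq_one fun b hb => div_self (sub_ne_zero.2 fun h => ?_)
  exact Finset.ne_of_mem_erase hb (hy h).symm

theorem lagrangeKernel_of_ne {N : ℕ} (y : Fin N → ℂˣ) {a b : Fin N} (hab : a ≠ b) :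
    lagrangeKernel y a (y b) = 0 := by
  rw [lagrangeKernel, Finset.prod_eq_zero (i := b) (by simp [hab.symm]) (by simp), mul_zero]

/-- As a function of one of its variables a Vandermonde product is proportional to the product of
the differences to the other variables. -/
theorem vandermonde_exchange {N : ℕ} (x x' : Fin N → ℂ) (a : Fin N) (h : ∀ b, b ≠ a → x' b = x b) :
    (∏ c, ∏ b ∈ Finset.Iio c, (x c - x b)) * ∏ b ∈ Finset.univ.erase a, (x' a - x' b) =
      (∏ c, ∏ b ∈ Finset.Iio c, (x' c - x' b)) * ∏ b ∈ Finset.univ.erase a, (x a - x b) := by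
  have key : ∀ y : Fin N → ℂ, (∀ b, b ≠ a → y b = x b) →
      ∏ c, ∏ b ∈ Finset.Iio c, (y c - y b) =
        (∏ c ∈ Finset.univ.erase a, (if a < c then -1 else 1) *
          ∏ b ∈ (Finset.Iio c).erase a, (x c - x b)) *
            ∏ b ∈ Finset.univ.erase a, (y a - y b) := by
    intro y hy
    have h1 : ∏ b ∈ Finset.Iio a, (y a - y b) =
        ∏ c ∈ Finset.univ.erase a, if c < a then y a - y c else 1 := by
      rw [← Finset.prod_filter]
      refine Finset.prod_congr ?_ fun _ _ => rfl
      ext b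
      simp only [Finset.mem_Iio, Finset.mem_filter, Finset.mem_erase, Finset.mem_univ, and_true]
      exact ⟨fun hb => ⟨hb.ne, hb⟩, fun hb => hb.2⟩
    rw [← Finset.mul_prod_erase Finset.univ _ (Finset.mem_univ a), h1, ← Finset.prod_mul_distrib,
      ← Finset.prod_mul_distrib]
    refine Finset.prod_congr rfl fun c hc => ?_
    have hca := Finset.ne_of_mem_erase hc
    have h2 : ∏ b ∈ (Finset.Iio c).erase a, (y c - y b) =
        ∏ b ∈ (Finset.Iio c).erase a, (x c - x b) :=
      Finset.prod_congr rfl fun b hb => by rw [hy c hca, hy b (Finset.ne_of_mem_erase hb)]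
    rcases lt_or_gt_of_ne hca with hlt | hgt
    · rw [if_pos hlt, if_neg hlt.not_gt, ← h2, Finset.erase_eq_of_notMem (by simp [hlt.le])]
      ring
    · rw [if_neg hgt.not_gt, if_pos hgt, ← h2, ← Finset.mul_prod_erase (Finset.Iio c) _
        (Finset.mem_Iio.2 hgt)]
      ring
  rw [key x fun _ _ => rfl, key x' h]
  ring

/-! ### Diagonalization in a separated basis -/

/-- The configuration `h` with the entry at `a` exchanged between `0` and `1`. -/
def flip {N : ℕ} (h : Config N) (a : Fin N) : Config N := Function.update h a (1 - h a)

theorem flip_apply_self {N : ℕ} (h : Config N) (a : Fin N) : flip h a a = 1 - h a := by simp [flip]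

theorem flip_apply_of_ne {N : ℕ} (h : Config N) {a b : Fin N} (hab : b ≠ a) :
    flip h a b = h b := by simp [flip, hab]

theorem flip_flip {N : ℕ} (h : Config N) (a : Fin N) : flip (flip h a) a = h := by
  simp [flip]

theorem sovPoint_flip_of_ne {N : ℕ} (q : ℂˣ) (η : Fin N → ℂˣ) (h : Config N) {a b : Fin N}
    (hab : b ≠ a) : sovPoint q η (flip h a) b = sovPoint q η h b := by
  rw [sovPoint, sovPoint, flip_apply_of_ne h hab]

theorem Generic.sovPoint_sq_injective {N : ℕ} {q : ℂˣ} {η : Fin N → ℂˣ} (hg : Generic q η)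
    (h : Config N) : Function.Injective fun a => (sovPoint q η h a : ℂ) ^ 2 := by
  intro a b hab
  by_contra hne
  have hq := pow_ne_zero 2 q.ne_zero
  have e := hg.sq_ne a b hne
  have e1 := hg.sq_ne_shift a b
  have e2 := hg.sq_ne_shift b a
  simp only [sovPoint, Units.val_div_eq_div_val, Units.val_pow_eq_pow_val, div_pow] at hab
  rcases (show h a = 0 ∨ h a = 1 by omega) with ha | ha <;>
    rcases (show h b = 0 ∨ h b = 1 by omega) with hb | hb <;>
    simp only [ha, hb, Fin.val_zero, Fin.val_one, pow_zero, one_pow, div_one, pow_one] at hab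
  · exact e hab
  · rw [eq_div_iff hq] at hab
    exact e2 (by rw [← hab]; ring)
  · rw [div_eq_iff hq] at hab
    exact e1 (by rw [hab]; ring)
  · exact e ((div_left_inj' hq).1 hab)

/-- The coefficient of a separate state without its wave function. -/
def sovWeight {N : ℕ} (q : ℂˣ) (η : Fin N → ℂˣ) (h : Config N) : ℂ := sovCoeff q η (fun _ => 1) h

theorem sovCoeff_eq {N : ℕ} (q : ℂˣ) (η : Fin N → ℂˣ) (Q : ℂˣ → ℂ) (h : Config N) :
    sovCoeff q η Q h = (∏ a, Q (sovPoint q η h a)) * sovWeight q η h := by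
  simp only [sovCoeff, sovWeight, Finset.prod_div_distrib, Finset.prod_const_one]
  ring

theorem Generic.sovWeight_ne_zero {N : ℕ} {q : ℂˣ} {η : Fin N → ℂˣ} (hg : Generic q η)
    (h : Config N) : sovWeight q η h ≠ 0 := by
  rw [sovWeight, sovCoeff]
  refine mul_ne_zero (Finset.prod_ne_zero_iff.2 fun a _ => ?_)
    (Finset.prod_ne_zero_iff.2 fun a _ => Finset.prod_ne_zero_iff.2 fun b hb => ?_)
  · exact div_ne_zero one_ne_zero (pow_ne_zero _ (Units.ne_zero _))
  · rw [sub_ne_zero]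
    intro hab
    exact (Finset.mem_Iio.1 hb).ne' (hg.sovPoint_sq_injective h hab)

/-- The weight is designed so that its product with the interpolation kernel of the site `a` does
not depend on `h_a`. -/
theorem Generic.sovWeight_mul_lagrangeKernel {N : ℕ} {q : ℂˣ} {η : Fin N → ℂˣ} (hg : Generic q η)
    (h : Config N) (a : Fin N) (l : ℂˣ) :
    sovWeight q η (flip h a) * lagrangeKernel (sovPoint q η (flip h a)) a l =
      sovWeight q η h * lagrangeKernel (sovPoint q η h) a l := by
  have hv := vandermonde_exchange (fun b => (sovPoint q η h b : ℂ) ^ 2)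
    (fun b => (sovPoint q η (flip h a) b : ℂ) ^ 2) a
    (fun b hb => by rw [sovPoint_flip_of_ne q η h hb])
  have hp : ∀ h' : Config N, ∏ b ∈ Finset.univ.erase a,
      ((sovPoint q η h' a : ℂ) ^ 2 - (sovPoint q η h' b : ℂ) ^ 2) ≠ 0 := fun h' =>
    Finset.prod_ne_zero_iff.2 fun b hb => sub_ne_zero.2 fun hab =>
      Finset.ne_of_mem_erase hb (hg.sovPoint_sq_injective h' hab).symm
  have hpow : ∀ h' : Config N, (sovPoint q η h' a : ℂ) ^ (N - 1) ≠ 0 := fun h' =>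
    pow_ne_zero _ (Units.ne_zero _)
  have hform : ∀ h' : Config N,
      sovWeight q η h' * lagrangeKernel (sovPoint q η h') a l =
        (∏ b ∈ Finset.univ.erase a, (1 / (sovPoint q η h' b : ℂ) ^ (N - 1) *
          ((l : ℂ) ^ 2 - (sovPoint q η h' b : ℂ) ^ 2))) / (l : ℂ) ^ (N - 1) *
        ((∏ c, ∏ b ∈ Finset.Iio c,
            ((sovPoint q η h' c : ℂ) ^ 2 - (sovPoint q η h' b : ℂ) ^ 2)) /
          ∏ b ∈ Finset.univ.erase a,
            ((sovPoint q η h' a : ℂ) ^ 2 - (sovPoint q η h' b : ℂ) ^ 2)) := fun h' => by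
    rw [sovWeight, sovCoeff, lagrangeKernel, ← Finset.mul_prod_erase Finset.univ _
      (Finset.mem_univ a), Finset.prod_div_distrib (s := Finset.univ.erase a) (f := fun b =>
        (l : ℂ) ^ 2 - (sovPoint q η h' b : ℂ) ^ 2), Finset.prod_mul_distrib]
    have h1 := hp h'
    have h2 := hpow h'
    field_simp
  rw [hform, hform]
  congr 1
  · congr 1
    refine Finset.prod_congr rfl fun b hb => ?_
    rw [sovPoint_flip_of_ne q η h (Finset.ne_of_mem_erase hb)]
  · rw [div_eq_div_iff (hp _) (hp _)]
    exact hv.symm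

/-- A family of operators `T` with entries of the right degree and parity, and a basis `w` on which
`T (η_a)` raises `h_a` with factor `α_a` while `T (η_a / q)` lowers `h_a` with factor `β_a`. -/
structure IsSeparated {N : ℕ} (q : ℂˣ) (η : Fin N → ℂˣ) (T : ℂˣ → Op N) (α β : Fin N → ℂ)
    (w : Config N → Config N → ℂ) : Prop where
  mem_parityClass : ∀ x z, (fun l => T l x z) ∈ parityClass N
  linearIndependent : LinearIndependent ℂ w
  move : ∀ h a, T (sovPoint q η h a) *ᵥ w h = (if h a = 0 then α a else β a) • w (flip h a)
  alpha_ne_zero : ∀ a, α a ≠ 0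
  beta_ne_zero : ∀ a, β a ≠ 0

/-- The vectors `v` with `T l *ᵥ v = t l • v` for all `l`. -/
def IsJointEigen {N : ℕ} (T : ℂˣ → Op N) (t : ℂˣ → ℂ) (v : Config N → ℂ) : Prop :=
  ∀ l, T l *ᵥ v = t l • v

/-- The vector with wave function `u` in the basis `w`, normalized by the weights. -/
def waveVector {N : ℕ} (q : ℂˣ) (η : Fin N → ℂˣ) (w : Config N → Config N → ℂ)
    (u : Config N → ℂ) : Config N → ℂ :=
  ∑ h, (u h * sovWeight q η h) • w h

/-- The discrete Baxter equations for the wave function `u`. -/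
def IsBaxter {N : ℕ} (q : ℂˣ) (η : Fin N → ℂˣ) (α β : Fin N → ℂ) (t : ℂˣ → ℂ)
    (u : Config N → ℂ) : Prop :=
  ∀ h a, (if h a = 0 then β a else α a) * u (flip h a) = t (sovPoint q η h a) * u h

section Separated

variable {N : ℕ} {q : ℂˣ} {η : Fin N → ℂˣ} {T : ℂˣ → Op N} {α β : Fin N → ℂ}
  {w : Config N → Config N → ℂ}

theorem IsSeparated.mulVec_interpolation (hT : IsSeparated q η T α β w) (hN : 1 ≤ N)
    {y : Fin N → ℂˣ} (hy : Function.Injective fun a => (y a : ℂ) ^ 2) (l : ℂˣ) (v : Config N → ℂ) :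
    T l *ᵥ v = ∑ a, lagrangeKernel y a l • (T (y a) *ᵥ v) := by
  funext x
  have hmem : (fun l => (T l *ᵥ v) x) ∈ parityClass N := by
    have : (fun l => (T l *ᵥ v) x) = ∑ z, v z • fun l => T l x z := by
      funext l
      simp [Matrix.mulVec, dotProduct, mul_comm]
    rw [this]
    exact Submodule.sum_mem _ fun z _ => Submodule.smul_mem _ _ (hT.mem_parityClass x z)
  rw [Finset.sum_apply]
  exact parityClass_interpolation hN hmem hy l

/-- The action of `T l` on wave functions, by interpolation in the nodes `η_a q^{-h_a}`, which depend
on the basis state; the weights make the kernel that of the target state. -/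
theorem IsSeparated.mulVec_waveVector (hT : IsSeparated q η T α β w) (hN : 1 ≤ N)
    (hg : Generic q η) (u : Config N → ℂ) (l : ℂˣ) :
    T l *ᵥ waveVector q η w u = waveVector q η w fun h =>
      ∑ a, lagrangeKernel (sovPoint q η h) a l * ((if h a = 0 then β a else α a) * u (flip h a)) := by
  have h1 : ∀ h, T l *ᵥ w h = ∑ a, (lagrangeKernel (sovPoint q η h) a l *
      (if h a = 0 then α a else β a)) • w (flip h a) := fun h => by
    rw [hT.mulVec_interpolation hN (hg.sovPoint_sq_injective h) l]
    simp only [hT.move, smul_smul]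
  simp only [waveVector, Matrix.mulVec_sum, Matrix.mulVec_smul, h1, Finset.smul_sum,
    Finset.sum_mul, Finset.sum_smul, smul_smul]
  rw [Finset.sum_comm, Finset.sum_comm (s := Finset.univ (α := Config N))]
  refine Finset.sum_congr rfl fun a _ => ?_
  refine Finset.sum_nbij' (fun h => flip h a) (fun h => flip h a) (by simp) (by simp)
    (fun h _ => flip_flip h a) (fun h _ => flip_flip h a) fun h _ => ?_
  rw [flip_flip, flip_apply_self]
  have h2 := hg.sovWeight_mul_lagrangeKernel h a l
  have h3 : (if 1 - h a = 0 then β a else α a) = if h a = 0 then α a else β a := by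
    rcases (show h a = 0 ∨ h a = 1 by omega) with ha | ha <;> simp [ha]
  rw [h3]
  congr 1
  linear_combination (-(u h * (if h a = 0 then α a else β a))) * h2

theorem IsSeparated.waveVector_injective (hT : IsSeparated q η T α β w) (hg : Generic q η) :
    Function.Injective (waveVector q η w) := by
  intro u u' huu
  funext h
  have h1 : ∑ h, ((u h - u' h) * sovWeight q η h) • w h = 0 := by
    simp only [sub_mul, sub_smul, Finset.sum_sub_distrib]
    exact sub_eq_zero.2 huu
  have h2 := Fintype.linearIndependent_iff.1 hT.linearIndependent _ h1 h
  exact sub_eq_zero.1 ((mul_eq_zero.1 h2).resolve_right (hg.sovWeight_ne_zero h))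

theorem IsSeparated.waveVector_surjective (hT : IsSeparated q η T α β w) (hg : Generic q η) :
    Function.Surjective (waveVector q η w) := by
  intro v
  let B := basisOfLinearIndependentOfCardEqFinrank hT.linearIndependent (by simp)
  refine ⟨fun h => B.repr v h / sovWeight q η h, ?_⟩
  simp only [waveVector, div_mul_cancel₀ _ (hg.sovWeight_ne_zero _)]
  conv_rhs => rw [← B.sum_repr v]
  simp [B]

theorem waveVector_smul (c : ℂ) (u : Config N → ℂ) :
    waveVector q η w (c • u) = c • waveVector q η w u := by
  simp only [waveVector, Finset.smul_sum, smul_smul, Pi.smul_apply, smul_eq_mul, mul_assoc]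

theorem IsSeparated.waveVector_eq_zero_iff (hT : IsSeparated q η T α β w) (hg : Generic q η)
    (u : Config N → ℂ) : waveVector q η w u = 0 ↔ u = 0 := by
  have h0 : waveVector q η w 0 = 0 := by simp [waveVector]
  conv_lhs => rw [← h0]
  exact (hT.waveVector_injective hg).eq_iff

theorem IsSeparated.isBaxter_of_isJointEigen (hT : IsSeparated q η T α β w) (hN : 1 ≤ N)
    (hg : Generic q η) {t : ℂˣ → ℂ} {u : Config N → ℂ}
    (hu : IsJointEigen T t (waveVector q η w u)) : IsBaxter q η α β t u := by
  intro h a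
  have h1 := hu (sovPoint q η h a)
  rw [hT.mulVec_waveVector hN hg, ← waveVector_smul] at h1
  have h2 := congrFun (hT.waveVector_injective hg h1) h
  rw [Finset.sum_eq_single a (fun b _ hb => by rw [lagrangeKernel_of_ne _ hb, zero_mul]) (by simp),
    lagrangeKernel_self (hg.sovPoint_sq_injective h), one_mul] at h2
  exact h2

theorem IsSeparated.isJointEigen_of_isBaxter (hT : IsSeparated q η T α β w) (hN : 1 ≤ N)
    (hg : Generic q η) {t : ℂˣ → ℂ} (ht : t ∈ parityClass N) {u : Config N → ℂ}
    (hu : IsBaxter q η α β t u) : IsJointEigen T t (waveVector q η w u) := by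
  intro l
  rw [hT.mulVec_waveVector hN hg, ← waveVector_smul]
  congr 1
  funext h
  simp only [hu h, ← mul_assoc]
  rw [← Finset.sum_mul, ← parityClass_interpolation hN ht (hg.sovPoint_sq_injective h), Pi.smul_apply,
    smul_eq_mul]

/-- The Baxter equations connect all configurations, so that a solution is determined by its value
at one of them. -/
theorem IsBaxter.eq_zero (hβ : ∀ a, β a ≠ 0) {t : ℂˣ → ℂ} {u : Config N → ℂ}
    (hu : IsBaxter q η α β t u) (h0 : u 0 = 0) : u = 0 := by
  funext h
  induction h using config_induction with
  | h0 => exact h0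
  | hstep h a ha ih =>
    have h1 := hu h a
    rw [ih, Pi.zero_apply, mul_zero, if_pos ha] at h1
    have h2 : flip h a = Function.update h a 1 := by simp [flip, ha]
    rw [← h2]
    exact (mul_eq_zero.1 h1).resolve_left (hβ a)

theorem sovPoint_zero (a : Fin N) : sovPoint q η 0 a = η a := by simp [sovPoint]

theorem sovPoint_flip_zero (a : Fin N) : sovPoint q η (flip 0 a) a = η a / q := by
  simp [sovPoint, flip]

theorem IsSeparated.mem_parityClass_of_isJointEigen (hT : IsSeparated q η T α β w) {t : ℂˣ → ℂ}
    {v : Config N → ℂ} (hv : v ≠ 0) (h : IsJointEigen T t v) : t ∈ parityClass N := by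
  obtain ⟨x, hx⟩ := Function.ne_iff.1 hv
  have : t = ∑ z, (v z / v x) • fun l => T l x z := by
    funext l
    have h1 := congrFun (h l) x
    rw [Pi.smul_apply, smul_eq_mul] at h1
    rw [eq_comm, ← mul_left_inj' hx, ← h1]
    simp only [Matrix.mulVec, dotProduct, Finset.sum_apply, Pi.smul_apply, smul_eq_mul,
      Finset.sum_mul]
    refine Finset.sum_congr rfl fun z _ => ?_
    rw [Pi.zero_apply] at hx
    field_simp
  rw [this]
  exact Submodule.sum_mem _ fun z _ => Submodule.smul_mem _ _ (hT.mem_parityClass x z)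

theorem IsSeparated.mul_eq_of_isJointEigen (hT : IsSeparated q η T α β w) (hN : 1 ≤ N)
    (hg : Generic q η) {t : ℂˣ → ℂ} {v : Config N → ℂ} (hv : v ≠ 0) (h : IsJointEigen T t v)
    (a : Fin N) : t (η a) * t (η a / q) = α a * β a := by
  obtain ⟨u, rfl⟩ := hT.waveVector_surjective hg v
  have hB := hT.isBaxter_of_isJointEigen hN hg h
  have hu0 : u 0 ≠ 0 := fun h0 => hv <| by
    rw [hT.waveVector_eq_zero_iff hg]
    exact hB.eq_zero hT.beta_ne_zero h0
  have h1 := hB 0 a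
  have h2 := hB (flip 0 a) a
  rw [sovPoint_zero, Pi.zero_apply, if_pos rfl] at h1
  rw [sovPoint_flip_zero, flip_flip, flip_apply_self, Pi.zero_apply, if_neg (by simp)] at h2
  apply mul_right_cancel₀ hu0
  linear_combination (-t (η a / q)) * h1 - β a * h2

theorem IsSeparated.exists_smul_eq (hT : IsSeparated q η T α β w) (hN : 1 ≤ N)
    (hg : Generic q η) {t : ℂˣ → ℂ} {v v' : Config N → ℂ} (hv : v ≠ 0) (h : IsJointEigen T t v)
    (h' : IsJointEigen T t v') : ∃ c : ℂ, c • v = v' := by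
  obtain ⟨u, rfl⟩ := hT.waveVector_surjective hg v
  obtain ⟨u', rfl⟩ := hT.waveVector_surjective hg v'
  have hB := hT.isBaxter_of_isJointEigen hN hg h
  have hB' := hT.isBaxter_of_isJointEigen hN hg h'
  have hu0 : u 0 ≠ 0 := fun h0 => hv <| by
    rw [hT.waveVector_eq_zero_iff hg]
    exact hB.eq_zero hT.beta_ne_zero h0
  refine ⟨u' 0 / u 0, ?_⟩
  rw [← waveVector_smul]
  congr 1
  have hd : IsBaxter q η α β t ((u' 0 / u 0) • u - u') := fun h a => by
    simp only [Pi.sub_apply, Pi.smul_apply, smul_eq_mul]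
    linear_combination (u' 0 / u 0) * hB h a - hB' h a
  refine sub_eq_zero.1 (hd.eq_zero hT.beta_ne_zero ?_)
  simp [div_mul_cancel₀ _ hu0]

/-- For a product wave function the Baxter equations decouple into one relation for each site. -/
theorem isBaxter_prod_of_relations (hβ : ∀ a, β a ≠ 0) {t : ℂˣ → ℂ}
    (htt : ∀ a, t (η a) * t (η a / q) = α a * β a) {Q : ℂˣ → ℂ}
    (hQ : ∀ a, Q (η a) ≠ 0 ∧ Q (η a / q) / Q (η a) = t (η a) / β a) :
    IsBaxter q η α β t fun h => ∏ a, Q (sovPoint q η h a) := by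
  intro h a
  have hrest : ∏ b ∈ Finset.univ.erase a, Q (sovPoint q η (flip h a) b) =
      ∏ b ∈ Finset.univ.erase a, Q (sovPoint q η h b) :=
    Finset.prod_congr rfl fun b hb => by
      rw [sovPoint_flip_of_ne q η h (Finset.ne_of_mem_erase hb)]
  simp only [← Finset.mul_prod_erase Finset.univ _ (Finset.mem_univ a)]
  rw [hrest, ← mul_assoc, ← mul_assoc]
  congr 1
  obtain ⟨h0, h1⟩ := hQ a
  rw [div_eq_div_iff h0 (hβ a)] at h1
  simp only [sovPoint, flip_apply_self]
  rcases (show h a = 0 ∨ h a = 1 by omega) with ha | ha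
  · simp only [ha, sub_zero, if_true, Fin.val_zero, Fin.val_one, pow_one, pow_zero, div_one]
    linear_combination h1
  · simp only [ha, sub_self, Fin.val_zero, Fin.val_one, pow_one, pow_zero, div_one,
      one_ne_zero, if_false]
    apply mul_right_cancel₀ (hβ a)
    linear_combination (-t (η a / q)) * h1 - Q (η a) * htt a

theorem IsSeparated.relations_iff (hT : IsSeparated q η T α β w) (hN : 1 ≤ N)
    (hg : Generic q η) {t : ℂˣ → ℂ} (ht : t ∈ parityClass N)
    (htt : ∀ a, t (η a) * t (η a / q) = α a * β a) (Q : ℂˣ → ℂ) :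
    (∀ a, Q (η a) ≠ 0 ∧ Q (η a / q) / Q (η a) = t (η a) / β a) ↔
      (∑ h, sovCoeff q η Q h • w h ≠ 0 ∧ IsJointEigen T t (∑ h, sovCoeff q η Q h • w h)) := by
  have hw : ∑ h, sovCoeff q η Q h • w h =
      waveVector q η w fun h => ∏ a, Q (sovPoint q η h a) := by
    simp only [waveVector, sovCoeff_eq]
  have hu0 : (∏ a, Q (sovPoint q η 0 a)) = ∏ a, Q (η a) := by simp only [sovPoint_zero]
  rw [hw]
  constructor
  · intro hQ
    refine ⟨fun h0 => ?_, hT.isJointEigen_of_isBaxter hN hg ht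
      (isBaxter_prod_of_relations hT.beta_ne_zero htt hQ)⟩
    have h1 := congrFun ((hT.waveVector_eq_zero_iff hg _).1 h0) 0
    simp only [hu0, Pi.zero_apply] at h1
    obtain ⟨a, -, ha⟩ := Finset.prod_eq_zero_iff.1 h1
    exact (hQ a).1 ha
  · rintro ⟨hne, heig⟩ a
    have hB := hT.isBaxter_of_isJointEigen hN hg heig
    have hne0 : ∏ a, Q (η a) ≠ 0 := fun h0 => hne <| by
      rw [hT.waveVector_eq_zero_iff hg]
      exact hB.eq_zero hT.beta_ne_zero (hu0.trans h0)
    have hQ := fun a => Finset.prod_ne_zero_iff.1 hne0 a (Finset.mem_univ a)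
    refine ⟨hQ a, ?_⟩
    rw [div_eq_div_iff (hQ a) (hT.beta_ne_zero a)]
    have h1 := hB 0 a
    have hrest : ∏ b ∈ Finset.univ.erase a, Q (sovPoint q η (flip 0 a) b) =
        ∏ b ∈ Finset.univ.erase a, Q (η b) :=
      Finset.prod_congr rfl fun b hb => by
        rw [sovPoint_flip_of_ne q η 0 (Finset.ne_of_mem_erase hb), sovPoint_zero]
    simp only [hu0] at h1
    simp only [← Finset.mul_prod_erase Finset.univ _ (Finset.mem_univ a)] at h1
    rw [hrest, sovPoint_flip_zero, sovPoint_zero, Pi.zero_apply, if_pos rfl] at h1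
    have hr : ∏ b ∈ Finset.univ.erase a, Q (η b) ≠ 0 :=
      Finset.prod_ne_zero_iff.2 fun b _ => hQ b
    apply mul_right_cancel₀ hr
    linear_combination h1

/-- The relations prescribe `Q` at the `2 N` distinct points `η_a`, `η_a / q` only, up to a factor. -/
theorem Generic.exists_relations (hg : Generic q η) (t : ℂˣ → ℂ) (β : Fin N → ℂ) :
    ∃ Q : ℂˣ → ℂ, ∀ a, Q (η a) ≠ 0 ∧ Q (η a / q) / Q (η a) = t (η a) / β a := by
  have hinj : Function.Injective fun a => η a / q := fun a b hab => by
    by_contra hne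
    exact hg.sq_ne a b hne (by rw [div_left_injective hab])
  refine ⟨Function.extend (fun a => η a / q) (fun a => t (η a) / β a) 1, fun a => ?_⟩
  have h1 : Function.extend (fun a => η a / q) (fun a => t (η a) / β a) 1 (η a) = 1 := by
    rw [Function.extend_apply', Pi.one_apply]
    rintro ⟨b, hb⟩
    apply hg.sq_ne_shift b a
    rw [← hb, Units.val_div_eq_div_val, div_pow, mul_div_cancel₀]
    exact pow_ne_zero 2 q.ne_zero
  rw [h1, hinj.extend_apply]
  exact ⟨one_ne_zero, div_one _⟩

/-- The spectrum: compatibility of the two Baxter equations along each edge `h_a = 0, 1` is necessary,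
and sufficient because then a product wave function solves all of them. -/
theorem IsSeparated.exists_isJointEigen_iff (hT : IsSeparated q η T α β w) (hN : 1 ≤ N)
    (hg : Generic q η) (t : ℂˣ → ℂ) :
    (∃ v, v ≠ 0 ∧ IsJointEigen T t v) ↔
      t ∈ parityClass N ∧ ∀ a, t (η a) * t (η a / q) = α a * β a := by
  constructor
  · rintro ⟨v, hv, h⟩
    exact ⟨hT.mem_parityClass_of_isJointEigen hv h, hT.mul_eq_of_isJointEigen hN hg hv h⟩
  · rintro ⟨ht, htt⟩
    obtain ⟨Q, hQ⟩ := hg.exists_relations t β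
    exact ⟨_, (hT.relations_iff hN hg ht htt Q).1 hQ⟩

end Separated

/-! ### The separated bases of the antiperiodic chain -/

theorem generic_of_ne {N : ℕ} {q : ℂˣ} (hq : q ^ 2 ≠ 1) {η : Fin N → ℂˣ}
    (hη : ∀ a b : Fin N, a < b → ∀ j : ℤ, j ∈ ({-1, 0, 1} : Set ℤ) →
      η a ≠ q ^ j * η b ∧ η a ≠ -(q ^ j * η b)) : Generic q η := by
  have hsq : ∀ x y : ℂˣ, (x : ℂ) ^ 2 = (y : ℂ) ^ 2 → x = y ∨ x = -y := fun x y h => by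
    rcases sq_eq_sq_iff_eq_or_eq_neg.1 h with h | h
    · exact Or.inl (Units.ext h)
    · exact Or.inr (Units.ext (by rw [h, Units.val_neg]))
  constructor
  · intro a b hab h
    rcases lt_or_gt_of_ne hab with hlt | hgt
    · have h1 := hη a b hlt 0 (by simp)
      rw [zpow_zero, one_mul] at h1
      exact (hsq _ _ h).elim h1.1 h1.2
    · have h1 := hη b a hgt 0 (by simp)
      rw [zpow_zero, one_mul] at h1
      exact (hsq _ _ h.symm).elim h1.1 h1.2
  · intro a b h
    rcases lt_trichotomy a b with hlt | heq | hgt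
    · have h1 := hη a b hlt 1 (by simp)
      rw [zpow_one] at h1
      rw [← mul_pow, ← Units.val_mul] at h
      exact (hsq _ _ h).elim h1.1 h1.2
    · subst heq
      apply hq
      have h0 := pow_ne_zero 2 (η a).ne_zero
      have h1 : (q : ℂ) ^ 2 = 1 := mul_right_cancel₀ h0 (by rw [one_mul]; exact h.symm)
      exact Units.ext (by rw [Units.val_pow_eq_pow_val, h1, Units.val_one])
    · have h1 := hη b a hgt (-1) (by simp)
      rw [zpow_neg_one] at h1
      have h2 : (η b : ℂ) ^ 2 = ((q⁻¹ * η a : ℂˣ) : ℂ) ^ 2 := by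
        rw [Units.val_mul, mul_pow, h, ← mul_assoc, ← mul_pow, ← Units.val_mul, inv_mul_cancel,
          Units.val_one, one_pow, one_mul]
      exact (hsq _ _ h2).elim h1.1 h1.2

theorem div_sub_div_ne_zero {x y : ℂ} (hx : x ≠ 0) (hy : y ≠ 0) (h : x ^ 2 ≠ y ^ 2) :
    x / y - y / x ≠ 0 := by
  rw [sub_ne_zero, Ne, div_eq_div_iff hy hx, ← sq, ← sq]
  exact h

section

variable {N : ℕ} {q : ℂˣ} {η : Fin N → ℂˣ}

theorem Generic.aFun_ne_zero (hg : Generic q η) (a : Fin N) : aFun q η (η a) ≠ 0 := by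
  refine neg_ne_zero.2 (Finset.prod_ne_zero_iff.2 fun n _ => ?_)
  refine div_sub_div_ne_zero (mul_ne_zero (Units.ne_zero _) (Units.ne_zero _))
    (Units.ne_zero _) fun h => hg.sq_ne_shift n a ?_
  rw [← h]
  ring

theorem Generic.dFun_ne_zero (hg : Generic q η) (a : Fin N) : dFun η (η a / q) ≠ 0 := by
  refine Finset.prod_ne_zero_iff.2 fun n _ => ?_
  refine div_sub_div_ne_zero (Units.ne_zero _) (Units.ne_zero _) fun h =>
    hg.sq_ne_shift a n ?_
  rw [← h, Units.val_div_eq_div_val, div_pow, mul_div_cancel₀ _ (pow_ne_zero 2 q.ne_zero)]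

theorem Generic.normConst_ne_zero (hg : Generic q η) : normConst η ≠ 0 := by
  refine Finset.prod_ne_zero_iff.2 fun a _ => Finset.prod_ne_zero_iff.2 fun b hb => ?_
  rw [Complex.cpow_ne_zero_iff]
  left
  exact div_sub_div_ne_zero (Units.ne_zero _) (Units.ne_zero _)
    (hg.sq_ne a b (Finset.mem_Iio.1 hb).ne')

theorem prod_siteDet {s : List (Fin N)} (hs : s.Nodup) (hmem : ∀ a, a ∈ s) (l : ℂˣ) :
    (s.map fun n => siteDet q (l / η n)).prod = -(aFun q η l * dFun η (l / q)) := by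
  have hu : s.toFinset = Finset.univ := by
    ext a
    simp [hmem]
  rw [← List.prod_toFinset _ hs, hu, aFun, dFun, neg_mul, neg_neg, ← Finset.prod_mul_distrib]
  refine Finset.prod_congr rfl fun n _ => ?_
  have hq := q.ne_zero
  have hl := l.ne_zero
  have hn := (η n).ne_zero
  rw [siteDet, Units.val_div_eq_div_val, Units.val_div_eq_div_val]
  field_simp

theorem prod_map_pow_update {N : ℕ} {m : List (Fin N)} (hm : m.Nodup) {f : Fin N → Op N}
    (hf : ∀ a b, Commute (f a) (f b)) (h : Config N) {a : Fin N} (ham : a ∈ m) (ha : h a = 0) :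
    (m.map fun n => f n ^ (Function.update h a 1 n : ℕ)).prod =
      f a * (m.map fun n => f n ^ (h n : ℕ)).prod := by
  induction m with
  | nil => simp at ham
  | cons n m ih =>
    rw [List.nodup_cons] at hm
    rw [List.map_cons, List.map_cons, List.prod_cons, List.prod_cons]
    by_cases hna : n = a
    · subst hna
      have hmap : (m.map fun k => f k ^ (Function.update h n 1 k : ℕ)) =
          m.map fun k => f k ^ (h k : ℕ) :=
        List.map_congr_left fun k hk => by
          have hkn : k ≠ n := fun hkn => hm.1 (hkn ▸ hk)
          rw [Function.update_of_ne hkn]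
      rw [hmap]
      simp [ha]
    · rw [ih hm.2 ((List.mem_cons.1 ham).resolve_left (Ne.symm hna)), Function.update_of_ne hna,
        ← mul_assoc, ← mul_assoc, ((hf n a).pow_left _).eq]

theorem Generic.isSovFamily (hg : Generic q η) {s m : List (Fin N)} (hs : s.Nodup) (hm : m.Nodup)
    (hmem : ∀ a, a ∈ m) (γ : Fin N → ℂ) {c : ℂ} (hc : c ≠ 0) :
    IsSovFamily q η s γ fun h => c • ((m.map fun n =>
      (γ n • mono q η s (η n) 0 1) ^ (h n : ℕ)).prod *ᵥ refState N) := by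
  refine ⟨⟨c, hc, by simp⟩, fun h a ha => ?_⟩
  rw [prod_map_pow_update (f := fun n => γ n • mono q η s (η n) 0 1) hm ?_ h (hmem a) ha,
    ← Matrix.mulVec_mulVec, Matrix.smul_mulVec, Matrix.mulVec_smul, smul_comm]
  intro a b
  refine Commute.smul_left (Commute.smul_right (mono_B_commute q η hs fun h1 => ?_) _) _
  apply hg.sq_ne_shift b a
  have hb := pow_ne_zero 2 (η b).ne_zero
  rw [Units.val_div_eq_div_val, mul_pow, div_pow, div_mul_eq_mul_div, div_eq_one_iff_eq hb] at h1
  rw [← h1, mul_comm]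

theorem IsSovFamily.isSeparated {s : List (Fin N)} {α β : Fin N → ℂ}
    {w : Config N → Config N → ℂ} (hw : IsSovFamily q η s (fun a => (α a)⁻¹) w)
    (hg : Generic q η) (hs : s.Nodup) (hmem : ∀ a, a ∈ s) (hα : ∀ a, α a ≠ 0)
    (hβ : ∀ a, β a ≠ 0) (hαβ : ∀ a, α a * β a = aFun q η (η a) * dFun η (η a / q)) :
    IsSeparated q η (fun l => mono q η s l 0 1 + mono q η s l 1 0) α β w where
  mem_parityClass x z := by
    have hlen : s.length = N := by
      have hu : s.toFinset = Finset.univ := by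
        ext a
        simp [hmem]
      rw [← List.toFinset_card_of_nodup hs, hu, Finset.card_fin]
    have h1 := mono_mem_parityClass q η s 0 1 x z
    have h2 := mono_mem_parityClass q η s 1 0 x z
    rw [hlen, if_neg (by simp), add_zero] at h1 h2
    exact add_mem h1 h2
  linearIndependent := hw.linearIndependent hg hs hmem (fun a => inv_ne_zero (hα a)) fun a => by
    rw [prod_siteDet hs hmem]
    exact neg_ne_zero.2 (mul_ne_zero (hg.aFun_ne_zero a) (hg.dFun_ne_zero a))
  move h a := by
    rcases (show h a = 0 ∨ h a = 1 by omega) with ha | ha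
    · have hp : sovPoint q η h a = η a := by simp [sovPoint, ha]
      have hf : flip h a = Function.update h a 1 := by simp [flip, ha]
      rw [hp, hf, if_pos ha, hw.transfer_raise hg hs hmem (fun a => inv_ne_zero (hα a)) h a ha,
        inv_inv]
    · have hp : sovPoint q η h a = η a / q := by simp [sovPoint, ha]
      have hf : Function.update (flip h a) a 1 = h := by simp [flip, ← ha]
      have h1 := hw.transfer_lower hg hs hmem (flip h a) a (by simp [flip, ha])
      rw [hf, prod_siteDet hs hmem, ← hαβ] at h1
      rw [hp, h1, if_neg (by simp [ha]), mul_neg, neg_neg, inv_mul_cancel_left₀ (hα a)]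
  alpha_ne_zero := hα
  beta_ne_zero := hβ

theorem Generic.isSeparated_sovKet (hg : Generic q η) :
    IsSeparated q η (transfer q η) (fun a => aFun q η (η a)) (fun a => dFun η (η a / q))
      (sovKet q η) := by
  have hs : (List.finRange N).reverse.Nodup := List.nodup_reverse.2 (List.nodup_finRange N)
  have h1 := (hg.isSovFamily hs (List.nodup_finRange N) (List.mem_finRange)
    (fun a => (aFun q η (η a))⁻¹) (inv_ne_zero hg.normConst_ne_zero)).isSeparated (α := fun a =>
      aFun q η (η a)) (β := fun a => dFun η (η a / q)) hg hs (by simp) hg.aFun_ne_zero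
      hg.dFun_ne_zero fun _ => rfl
  convert h1 using 1
  · funext l
    rw [transfer, opB, opC, monodromy_eq_mono]
  · funext h
    simp only [sovKet, opB, monodromy_eq_mono, List.ofFn_eq_map]

/-- Transposition turns the covectors built with `C` into vectors built with `B` for the sites in
reverse order. -/
theorem Generic.isSeparated_sovBra (hg : Generic q η) :
    IsSeparated q η (fun l => (transfer q η l)ᵀ) (fun a => dFun η (η a / q))
      (fun a => aFun q η (η a)) (sovBra q η) := by
  have hn := List.nodup_finRange N
  have hr : (List.finRange N).reverse.Nodup := List.nodup_reverse.2 hn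
  have h1 := (hg.isSovFamily hn hr (by simp)
    (fun a => (dFun η (η a / q))⁻¹) (inv_ne_zero hg.normConst_ne_zero)).isSeparated (α := fun a =>
      dFun η (η a / q)) (β := fun a => aFun q η (η a)) hg hn List.mem_finRange hg.dFun_ne_zero
      hg.aFun_ne_zero fun _ => mul_comm _ _
  have hB : ∀ l, (opB q η l)ᵀ = mono q η (List.finRange N) l 1 0 := fun l => by
    rw [opB, monodromy_eq_mono, mono_transpose q η hr, List.reverse_reverse]
  have hC : ∀ l, (opC q η l)ᵀ = mono q η (List.finRange N) l 0 1 := fun l => by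
    rw [opC, monodromy_eq_mono, mono_transpose q η hr, List.reverse_reverse]
  convert h1 using 1
  · funext l
    rw [transfer, Matrix.transpose_add, hB, hC, add_comm]
  · funext h
    rw [sovBra, ← Matrix.mulVec_transpose, Matrix.transpose_list_prod, List.ofFn_eq_map,
      List.map_map, ← List.map_reverse]
    simp only [Function.comp_def, Matrix.transpose_pow, Matrix.transpose_smul, hC]

theorem mem_leftEigenspace_iff {t : ℂˣ → ℂ} {v : Config N → ℂ} :
    v ∈ leftEigenspace q η t ↔ IsJointEigen (fun l => (transfer q η l)ᵀ) t v := by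
  simp only [IsJointEigen, Matrix.mulVec_transpose]
  rfl

theorem mem_rightEigenspace_iff {t : ℂˣ → ℂ} {v : Config N → ℂ} :
    v ∈ rightEigenspace q η t ↔ IsJointEigen (transfer q η) t v := Iff.rfl

theorem IsSeparated.finrank_eq_one {T : ℂˣ → Op N} {α β : Fin N → ℂ}
    {w : Config N → Config N → ℂ} (hT : IsSeparated q η T α β w) (hN : 1 ≤ N)
    (hg : Generic q η) {t : ℂˣ → ℂ} (ht : ∃ v, v ≠ 0 ∧ IsJointEigen T t v)
    {E : Submodule ℂ (Config N → ℂ)} (hE : ∀ v, v ∈ E ↔ IsJointEigen T t v) :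
    Module.finrank ℂ E = 1 := by
  obtain ⟨v, hv, h⟩ := ht
  rw [finrank_eq_one_iff']
  refine ⟨⟨v, (hE v).2 h⟩, fun h0 => hv (congrArg Subtype.val h0), fun v' => ?_⟩
  obtain ⟨c, hc⟩ := hT.exists_smul_eq hN hg hv h ((hE v').1 v'.2)
  exact ⟨c, Subtype.ext hc⟩

end

end AntiperiodicSixVertex

end

theorem mainTheorem1 (N : ℕ) (hN : 1 ≤ N) (q : ℂˣ) (hq : q ^ 2 ≠ 1) (η : Fin N → ℂˣ)
    (hη : ∀ a b : Fin N, a < b → ∀ j : ℤ, j ∈ ({-1, 0, 1} : Set ℤ) →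
      η a ≠ q ^ j * η b ∧ η a ≠ -(q ^ j * η b)) :
    -- the spectrum is simple
    (∀ t ∈ AntiperiodicSixVertex.spectrumT q η,
      Module.finrank ℂ (AntiperiodicSixVertex.rightEigenspace q η t) = 1 ∧
      Module.finrank ℂ (AntiperiodicSixVertex.leftEigenspace q η t) = 1) ∧
    -- characterization of the eigenvalue functions
    AntiperiodicSixVertex.spectrumT q η =
      {t | t ∈ AntiperiodicSixVertex.laurentClass N ∧
        ∀ a, t (η a) * t (η a / q) =
          AntiperiodicSixVertex.aFun q η (η a) * AntiperiodicSixVertex.dFun η (η a / q)} ∧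
    -- right eigenstates
    (∀ t ∈ AntiperiodicSixVertex.spectrumT q η,
      (∃ Q : ℂˣ → ℂ, ∀ a, Q (η a) ≠ 0 ∧
        Q (η a / q) / Q (η a) = t (η a) / AntiperiodicSixVertex.dFun η (η a / q)) ∧
      ∀ Q : ℂˣ → ℂ,
        (∀ a, Q (η a) ≠ 0 ∧
          Q (η a / q) / Q (η a) = t (η a) / AntiperiodicSixVertex.dFun η (η a / q)) ↔
        (AntiperiodicSixVertex.separateKet q η Q ≠ 0 ∧
          AntiperiodicSixVertex.separateKet q η Q ∈
            AntiperiodicSixVertex.rightEigenspace q η t)) ∧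
    -- left eigenstates
    (∀ t ∈ AntiperiodicSixVertex.spectrumT q η,
      (∃ Q : ℂˣ → ℂ, ∀ a, Q (η a) ≠ 0 ∧
        Q (η a / q) / Q (η a) = t (η a) / AntiperiodicSixVertex.aFun q η (η a)) ∧
      ∀ Q : ℂˣ → ℂ,
        (∀ a, Q (η a) ≠ 0 ∧
          Q (η a / q) / Q (η a) = t (η a) / AntiperiodicSixVertex.aFun q η (η a)) ↔
        (AntiperiodicSixVertex.separateBra q η Q ≠ 0 ∧
          AntiperiodicSixVertex.separateBra q η Q ∈
            AntiperiodicSixVertex.leftEigenspace q η t)) := by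
  have hg := AntiperiodicSixVertex.generic_of_ne hq hη
  have hR := hg.isSeparated_sovKet
  have hL := hg.isSeparated_sovBra
  have hspec : ∀ t, t ∈ AntiperiodicSixVertex.spectrumT q η ↔
      ∃ v, v ≠ 0 ∧ AntiperiodicSixVertex.IsJointEigen
        (AntiperiodicSixVertex.transfer q η) t v := fun t =>
    ⟨fun ⟨v, h, hv⟩ => ⟨v, hv, h⟩, fun ⟨v, hv, h⟩ => ⟨v, h, hv⟩⟩
  -- the two separated bases impose the same conditions on the eigenvalue
  have hspecL : ∀ t ∈ AntiperiodicSixVertex.spectrumT q η, ∃ v, v ≠ 0 ∧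
      AntiperiodicSixVertex.IsJointEigen
        (fun l => (AntiperiodicSixVertex.transfer q η l)ᵀ) t v := fun t ht => by
    obtain ⟨h1, h2⟩ := (hR.exists_isJointEigen_iff hN hg t).1 ((hspec t).1 ht)
    exact (hL.exists_isJointEigen_iff hN hg t).2 ⟨h1, fun a => (h2 a).trans (mul_comm _ _)⟩
  refine ⟨fun t ht => ⟨?_, ?_⟩, ?_, fun t ht => ⟨?_, fun Q => ?_⟩, fun t ht => ⟨?_, fun Q => ?_⟩⟩
  · exact hR.finrank_eq_one hN hg ((hspec t).1 ht)
      fun _ => AntiperiodicSixVertex.mem_rightEigenspace_iff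
  · exact hL.finrank_eq_one hN hg (hspecL t ht)
      fun _ => AntiperiodicSixVertex.mem_leftEigenspace_iff
  · ext t
    rw [hspec, hR.exists_isJointEigen_iff hN hg,
      AntiperiodicSixVertex.laurentClass_eq_parityClass hN]
    rfl
  · exact hg.exists_relations t _
  · obtain ⟨h1, h2⟩ := (hR.exists_isJointEigen_iff hN hg t).1 ((hspec t).1 ht)
    exact hR.relations_iff hN hg h1 h2 Q
  · exact hg.exists_relations t _
  · obtain ⟨h1, h2⟩ := (hL.exists_isJointEigen_iff hN hg t).1 (hspecL t ht)
    rw [AntiperiodicSixVertex.mem_leftEigenspace_iff]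
    exact hL.relations_iff hN hg h1 h2 Q
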